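/- Let $M$ be a finite-dimensional smooth manifold without boundary, $A\subset TM$ an open conic set of nonzero tangent vectors with projection $\pi:A\to M$, and $F:A\to(0,\infty)$ a Finsler function: $F$ is smooth, positively homogeneous of degree $1$ on fibres, and at each $z=(x,y)\in A$ the Hessian $g_z$ of $\tfrac12F^2|_{T_xM}$ at $y$ is nondegenerate. (The classical case is $A=TM\setminus 0$ with $g$ positive definite.) Let $\eta(z)=(z,z)$ be the fundamental section of the pullback bundle $\pi^{-1}(TM)\to A$. For a linear connection $D$ on this bundle put $H_z=\{X\in T_zA: D_X\eta=0\}$, $V_z=\ker(\pi_*)_z$, $\mathbf T(X,Y)=D_X\pi_*Y-D_Y\pi_*X-\pi_*[X,Y]$ and $\mathbf K(X,Y)\overline Z=D_XD_Y\overline Z-D_YD_X\overline Z-D_{[X,Y]}\overline Z$. Let $D$ be the Cartan connection of $F$, i.e. the smooth connection with $T_zA=V_z\oplus H_z$ for all $z$ (regularity), $Dg=0$, $\mathbf T(X,Y)=0$ for $X,Y\in H_z$, and $g(\mathbf T(V,X),\pi_*Y)=g(\mathbf T(V,Y),\pi_*X)$ for $V\in V_z$ and $X,Y\in H_z$. For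 $\overline X,\overline Y,\overline Z\in T_{\pi z}M$ let $R(\overline X,\overline Y)\overline Z=\mathbf K(X,Y)\overline Z$, where $X,Y\in H_z$ satisfy $\pi_*X=\overline X$, $\pi_*Y=\overline Y$, and let $\widehat R(\overline X,\overline Y)=R(\overline X,\overline Y)\eta$. For $z\in A$ put $$\mathcal N_R(z)=\pi_*\{X\in H_z:\ R(\pi_*X,\pi_*Y)\overline Z=0\ \ \forall\,Y\in H_z,\ \overline Z\in T_{\pi z}M\},$$ $$\mathrm{Ker}_R(z)=\{\overline X\in T_{\pi z}M:\ R(\pi_*Y,\pi_*Z)\overline X=0\ \ \forall\,Y,Z\in H_z\}.$$ Then $\widehat R=0$ if and only if the horizontal distribution is integrable (the bracket of any two smooth horizontal vector fields on an open subset of $A$ is horizontal). Moreover, suppose that one of the following conditions holds: (a) $\widehat R=0$; (b) there is a function $\lambda$ on $A$, positively homogeneous of degree $0$ in $y$, such that $\widehat R(\overline X,\overline Y)=\lambda F\,(\ell(\overline X)\overline Y-\ell(\overline Y)\overline X)$ for all $\overline X,\overline Y$, where $\ell(\overline X)=F^{-1}g(\overline X,\eta)$. Then the cyclic identity $R(\overline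 X,\overline Y)\overline Z+R(\overline Y,\overline Z)\overline X+R(\overline Z,\overline X)\overline Y=0$ holds on $A$, and $\mathcal N_R(z)=\mathrm{Ker}_R(z)$ for every $z\in A$. -/

import Mathlib

open Bundle Set TopologicalSpace
open scoped Manifold ContDiff Topology

namespace FinslerGeometry

noncomputable section

/-! ### The pullback bundle -/

/-- The footpoint map `π : A → M`, for an open subset `A` of the tangent bundle. -/
def footMap {E : Type*} [NormedAddCommGroup E] [NormedSpace ℝ E]
    {M : Type*} [TopologicalSpace M] [ChartedSpace E M] [IsManifold 𝓘(ℝ, E) ∞ M]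
    (A : Opens (TangentBundle 𝓘(ℝ, E) M)) :
    ContMDiffMap 𝓘(ℝ, E).tangent 𝓘(ℝ, E) A M ∞ :=
  ⟨fun z => z.1.proj, (contMDiff_proj (TangentSpace 𝓘(ℝ, E))).comp contMDiff_subtype_val⟩

/-- The pullback bundle `π⁻¹(TM)` over `A`: its fibre at `z` is `T_{π z} M`.  Its sections are the
`π`-vector fields. -/
abbrev PiFiber {E : Type*} [NormedAddCommGroup E] [NormedSpace ℝ E]
    {M : Type*} [TopologicalSpace M] [ChartedSpace E M] [IsManifold 𝓘(ℝ, E) ∞ M]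
    (A : Opens (TangentBundle 𝓘(ℝ, E) M)) : A → Type _ :=
  (footMap A : A → M) *ᵖ (TangentSpace 𝓘(ℝ, E) : M → Type _)

variable {E : Type*} [NormedAddCommGroup E] [NormedSpace ℝ E]
  {M : Type*} [TopologicalSpace M] [ChartedSpace E M] [IsManifold 𝓘(ℝ, E) ∞ M]

instance instAddCommGroupPiFiber (A : Opens (TangentBundle 𝓘(ℝ, E) M)) (z : A) :
    AddCommGroup (PiFiber A z) :=
  inferInstanceAs (AddCommGroup (TangentSpace 𝓘(ℝ, E) (footMap A z)))

instance instIsTopologicalAddGroupPiFiber (A : Opens (TangentBundle 𝓘(ℝ, E) M)) (z : A) :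
    IsTopologicalAddGroup (PiFiber A z) :=
  inferInstanceAs (IsTopologicalAddGroup (TangentSpace 𝓘(ℝ, E) (footMap A z)))

instance instContinuousSMulPiFiber (A : Opens (TangentBundle 𝓘(ℝ, E) M)) (z : A) :
    ContinuousSMul ℝ (PiFiber A z) :=
  inferInstanceAs (ContinuousSMul ℝ (TangentSpace 𝓘(ℝ, E) (footMap A z)))

/-- The differential `π_* : T_z A → T_{π z} M` of the footpoint map. -/
def piStar (A : Opens (TangentBundle 𝓘(ℝ, E) M)) (z : A) :
    TangentSpace 𝓘(ℝ, E).tangent z →L[ℝ] PiFiber A z :=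
  mfderiv 𝓘(ℝ, E).tangent 𝓘(ℝ, E) (footMap A) z

/-- The fundamental `π`-vector field `η(z) = (z, z)`. -/
def eta (A : Opens (TangentBundle 𝓘(ℝ, E) M)) (z : A) : PiFiber A z := z.1.snd

/-! ### Finsler functions -/

/-- The Finsler metric tensor `g`: at `z = (x, y)`, the second derivative at `y` of the restriction
of `F² / 2` to the tangent space `T_x M`. -/
def finslerMetric (F : TangentBundle 𝓘(ℝ, E) M → ℝ) (A : Opens (TangentBundle 𝓘(ℝ, E) M))
    (z : A) (a b : PiFiber A z) : ℝ :=
  fderiv ℝ (fderiv ℝ (fun u : E => F ⟨z.1.proj, u⟩ ^ 2 / 2)) z.1.snd a b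

/-- `F` is a Finsler function on the open conic set `A` of nonzero tangent vectors: it is positive
and smooth on `A`, positively homogeneous of degree one, and its metric tensor is nondegenerate.
The classical case is that of the set `A` of all nonzero tangent vectors, with `g` positive
definite. -/
structure IsFinslerFunction (F : TangentBundle 𝓘(ℝ, E) M → ℝ)
    (A : Opens (TangentBundle 𝓘(ℝ, E) M)) : Prop where
  ne_zero : ∀ z ∈ A, z.snd ≠ 0
  conic : ∀ z ∈ A, ∀ t : ℝ, 0 < t → (⟨z.proj, t • z.snd⟩ : TangentBundle 𝓘(ℝ, E) M) ∈ A
  pos : ∀ z ∈ A, 0 < F z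
  homogeneous : ∀ z ∈ A, ∀ t : ℝ, 0 < t → F ⟨z.proj, t • z.snd⟩ = t * F z
  smooth : ContMDiffOn 𝓘(ℝ, E).tangent 𝓘(ℝ) ∞ F A
  nondegenerate : ∀ (z : A) (a : PiFiber A z), (∀ b, finslerMetric F A z a b = 0) → a = 0

/-! ### Connections on the pullback bundle -/

/-- Linear connections on the pullback bundle `π⁻¹(TM) → A`.  For such a `D`, the vector `D_X σ`
at `z` is `D σ z X`. -/
abbrev PiConnection (A : Opens (TangentBundle 𝓘(ℝ, E) M)) : Type _ :=
  CovariantDerivative 𝓘(ℝ, E).tangent E (PiFiber A)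

variable {A : Opens (TangentBundle 𝓘(ℝ, E) M)}

/-- The vertical space at `z`, the kernel of `π_*`. -/
def verticalSpace (A : Opens (TangentBundle 𝓘(ℝ, E) M)) (z : A) :
    Submodule ℝ (TangentSpace 𝓘(ℝ, E).tangent z) :=
  LinearMap.ker (piStar A z).toLinearMap

/-- The horizontal space of `D` at `z`, the kernel of the connection map `K : X ↦ D_X η`. -/
def horizontalSpace (D : PiConnection A) (z : A) :
    Submodule ℝ (TangentSpace 𝓘(ℝ, E).tangent z) :=
  LinearMap.ker (D (eta A) z).toLinearMap

/-- The classical torsion `𝐓(X, Y) = D_X (π_* Y) - D_Y (π_* X) - π_* [X, Y]` of vector fields. -/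
def torsionField (D : PiConnection A) (X Y : ∀ z : A, TangentSpace 𝓘(ℝ, E).tangent z) (z : A) :
    PiFiber A z :=
  D (fun w => piStar A w (Y w)) z (X z) - D (fun w => piStar A w (X w)) z (Y z)
    - piStar A z (VectorField.mlieBracket 𝓘(ℝ, E).tangent X Y z)

/-- The classical torsion tensor at `z`; it is evaluated on the extensions of the two tangent
vectors that are constant in the preferred trivialization at `z`, and does not depend on the
choice of the extensions. -/
def torsion (D : PiConnection A) (z : A) (u v : TangentSpace 𝓘(ℝ, E).tangent z) : PiFiber A z :=
  torsionField D (FiberBundle.extend (E × E) u) (FiberBundle.extend (E × E) v) z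

/-- The classical curvature `𝐊(X, Y) σ = D_X D_Y σ - D_Y D_X σ - D_[X, Y] σ`, for vector fields
`X`, `Y` and a `π`-vector field `σ`. -/
def curvatureField (D : PiConnection A) (X Y : ∀ z : A, TangentSpace 𝓘(ℝ, E).tangent z)
    (σ : ∀ z : A, PiFiber A z) (z : A) : PiFiber A z :=
  D (fun w => D σ w (Y w)) z (X z) - D (fun w => D σ w (X w)) z (Y z)
    - D σ z (VectorField.mlieBracket 𝓘(ℝ, E).tangent X Y z)

/-- The classical curvature tensor at `z`, evaluated on extensions as for the torsion. -/
def curvature (D : PiConnection A) (z : A) (u v : TangentSpace 𝓘(ℝ, E).tangent z)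
    (c : PiFiber A z) : PiFiber A z :=
  curvatureField D (FiberBundle.extend (E × E) u) (FiberBundle.extend (E × E) v)
    (FiberBundle.extend E c) z

/-- `D` is the Cartan connection of the Finsler function `F` on `A`: the smooth regular connection
that is metrical, has vanishing (h)h-torsion, and whose (h)hv-torsion is symmetric with respect
to `g`. -/
structure IsCartanConnection (F : TangentBundle 𝓘(ℝ, E) M → ℝ) (D : PiConnection A) : Prop where
  smooth : ∀ U : Set A, IsOpen U → ContMDiffCovariantDerivativeOn E ∞ D U
  regular : ∀ z : A, IsCompl (verticalSpace A z) (horizontalSpace D z)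
  metrical : ∀ (z : A) (X : TangentSpace 𝓘(ℝ, E).tangent z) (σ τ : ∀ w : A, PiFiber A w),
    MDifferentiableAt 𝓘(ℝ, E).tangent (𝓘(ℝ, E).tangent.prod 𝓘(ℝ, E))
      (fun w => (⟨w, σ w⟩ : TotalSpace E (PiFiber A))) z →
    MDifferentiableAt 𝓘(ℝ, E).tangent (𝓘(ℝ, E).tangent.prod 𝓘(ℝ, E))
      (fun w => (⟨w, τ w⟩ : TotalSpace E (PiFiber A))) z →
    mfderiv 𝓘(ℝ, E).tangent 𝓘(ℝ) (fun w => finslerMetric F A w (σ w) (τ w)) z X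
      = finslerMetric F A z (D σ z X) (τ z) + finslerMetric F A z (σ z) (D τ z X)
  hTorsion_eq_zero : ∀ z : A, ∀ X ∈ horizontalSpace D z, ∀ Y ∈ horizontalSpace D z,
    torsion D z X Y = 0
  hvTorsion_symm : ∀ z : A, ∀ V ∈ verticalSpace A z,
    ∀ X ∈ horizontalSpace D z, ∀ Y ∈ horizontalSpace D z,
    finslerMetric F A z (torsion D z V X) (piStar A z Y)
      = finslerMetric F A z (torsion D z V Y) (piStar A z X)

/-! ### The h-curvature, its nullity spaces and its kernel spaces -/

/-- The horizontal lift of `a ∈ T_{π z} M`: the vector `X` in the horizontal space at `z` with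
`π_* X = a`, which exists and is unique if `D` is regular. -/
def horizontalLift (D : PiConnection A) (z : A) (a : PiFiber A z) :
    TangentSpace 𝓘(ℝ, E).tangent z :=
  Function.invFunOn (fun X => piStar A z X) (horizontalSpace D z : Set _) a

/-- The h-curvature tensor `R(a, b) c = 𝐊(X, Y) c`, with `X`, `Y` horizontal over `a`, `b`. -/
def hCurvature (D : PiConnection A) (z : A) (a b c : PiFiber A z) : PiFiber A z :=
  curvature D z (horizontalLift D z a) (horizontalLift D z b) c

/-- The contracted curvature `R̂(a, b) = R(a, b) η`. -/
def contractedCurvature (D : PiConnection A) (z : A) (a b : PiFiber A z) : PiFiber A z :=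
  hCurvature D z a b (eta A z)

/-- The nullity space of `R` at `z`, inside the horizontal space. -/
def horizontalNullitySpace (D : PiConnection A) (z : A) :
    Set (TangentSpace 𝓘(ℝ, E).tangent z) :=
  {X | X ∈ horizontalSpace D z ∧ ∀ Y ∈ horizontalSpace D z, ∀ c : PiFiber A z,
    hCurvature D z (piStar A z X) (piStar A z Y) c = 0}

/-- The nullity space `N_R` at `z`, as a subset of `T_{π z} M`. -/
def nullitySpace (D : PiConnection A) (z : A) : Set (PiFiber A z) :=
  piStar A z '' horizontalNullitySpace D z

/-- The kernel `Ker_R` at `z`, a subset of `T_{π z} M`. -/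
def kernelSpace (D : PiConnection A) (z : A) : Set (PiFiber A z) :=
  {c | ∀ Y ∈ horizontalSpace D z, ∀ Z ∈ horizontalSpace D z,
    hCurvature D z (piStar A z Y) (piStar A z Z) c = 0}

/-- The cyclic identity `R(a, b) c + R(b, c) a + R(c, a) b = 0`. -/
def CyclicIdentity (D : PiConnection A) : Prop :=
  ∀ (z : A) (a b c : PiFiber A z),
    hCurvature D z a b c + hCurvature D z b c a + hCurvature D z c a b = 0

/-- Integrability of the horizontal distribution: the bracket of two horizontal vector fields
is horizontal. -/
def HorizontalIntegrable (D : PiConnection A) : Prop :=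
  ∀ U : Set A, IsOpen U → ∀ X Y : (∀ z : A, TangentSpace 𝓘(ℝ, E).tangent z),
    ContMDiffOn 𝓘(ℝ, E).tangent 𝓘(ℝ, E).tangent.tangent ∞
      (fun z => (⟨z, X z⟩ : TangentBundle 𝓘(ℝ, E).tangent A)) U →
    ContMDiffOn 𝓘(ℝ, E).tangent 𝓘(ℝ, E).tangent.tangent ∞
      (fun z => (⟨z, Y z⟩ : TangentBundle 𝓘(ℝ, E).tangent A)) U →
    (∀ z ∈ U, X z ∈ horizontalSpace D z) → (∀ z ∈ U, Y z ∈ horizontalSpace D z) →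
    ∀ z ∈ U, VectorField.mlieBracket 𝓘(ℝ, E).tangent X Y z ∈ horizontalSpace D z

/-- The form `ℓ(a) = F⁻¹ g(a, η)`. -/
def ell (F : TangentBundle 𝓘(ℝ, E) M → ℝ) (A : Opens (TangentBundle 𝓘(ℝ, E) M)) (z : A)
    (a : PiFiber A z) : ℝ :=
  (F z.1)⁻¹ * finslerMetric F A z a (eta A z)

/-- The isotropy condition `R̂(a, b) = lam F (ℓ(a) b - ℓ(b) a)`, for a function `lam` on `A` that is
positively homogeneous of degree zero in `y`. -/
def IsotropyCondition (F : TangentBundle 𝓘(ℝ, E) M → ℝ) (D : PiConnection A) : Prop :=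
  ∃ lam : TangentBundle 𝓘(ℝ, E) M → ℝ,
    (∀ z ∈ A, ∀ t : ℝ, 0 < t → lam ⟨z.proj, t • z.snd⟩ = lam z) ∧
    ∀ (z : A) (a b : PiFiber A z),
      contractedCurvature D z a b = (lam z.1 * F z.1) • (ell F A z a • b - ell F A z b • a)

end

end FinslerGeometry

/-!
The proof is a computation in coordinates. In the chart of `A` and the trivialization of the
pullback bundle at a point, the connection is `D = d + Γ` (`covariantDerivative_coord`), its
torsion and curvature are given by the usual expressions in `Γ` (`torsion_coord`,
`curvature_eq_coord`), and `g` is the vertical Hessian of the energy `F² / 2`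
(`finslerMetric_coord`). Thus the axioms of the Cartan connection become identities between `Γ` and
`g` (`isCoordCartan`).

Put `C(v, a) = Γ(0, v) a` and `La = (a, -Γ(a, 0) y)`. Since `g` is parallel, `g(C(v, a), b)` is
symmetric in `a` and `b`, and `Dg = 0` in vertical directions gives that `2 g(C(v, a), b)` is the
vertical derivative of `g`, a third derivative of the energy. So `C` is symmetric, and `C(v, y) = 0`
by homogeneity. Hence the horizontal vectors are the `La`, and the vanishing of the
(h)h-torsion reads `Γ(La) b = Γ(Lb) a`. Differentiating this relation gives the first Bianchi
identity (`IsCoordCartan.cyclic_coordCurvature`): the cyclic sum of `R(a, b) c` equals the cyclic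
sum of `C(R̂(a, b), c)`.

If `R̂ = 0`, the right-hand side vanishes; if `R̂(a, b)` is a multiple of `ℓ(a) b - ℓ(b) a`, it
cancels by the symmetry of `C` (`cyclicIdentity_of_contracted`). The cyclic identity and the
skew-symmetry of the curvature of a metrical connection imply the pair symmetry
`g(R(a, b) c, d) = g(R(c, d) a, b)` (`finslerMetric_hCurvature_pair_symm`), and with the
nondegeneracy of `g` the nullity and the kernel spaces coincide.

For the criterion of integrability, `D_X η = D_Y η = 0` for horizontal fields `X`, `Y`, so that
`R̂(π_* X, π_* Y) = -D_[X, Y] η` (`contractedCurvature_eq_neg`), and horizontal fields through any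
two given vectors exist locally (`constLift`).
-/

namespace FinslerGeometry

/-! ### The Cartan connection in coordinates -/

/-- The curvature of the connection `d + Γ` on a trivial bundle with fibre `G` over an open subset
of `W`, evaluated on constant vector fields `X`, `Y` and a constant section `c`. -/
noncomputable def coordCurvature {W G : Type*} [NormedAddCommGroup W] [NormedSpace ℝ W]
    [NormedAddCommGroup G] [NormedSpace ℝ G] (Γ : W → W →L[ℝ] G →L[ℝ] G) (p X Y : W) (c : G) : G :=
  fderiv ℝ Γ p X Y c - fderiv ℝ Γ p Y X c + Γ p X (Γ p Y c) - Γ p Y (Γ p X c)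

section CoordinateCartan

set_option synthInstance.maxHeartbeats 100000

variable {E : Type*} [NormedAddCommGroup E] [NormedSpace ℝ E]

/-- The horizontal lift of `a` at `p = (x, y)` for the connection `d + Γ` in coordinates. Once
`Γ(0, v) y = 0` is known, it is the unique `X` over `a` with `D_X η = X.2 + Γ(X) y = 0`. -/
noncomputable def coordLift (Γ : E × E → E × E →L[ℝ] E →L[ℝ] E) (p : E × E) (a : E) : E × E :=
  (a, -Γ p (a, 0) p.2)

/-- The coordinate form of the Cartan connection on an open set `Ω` of points `p = (x, y)`: the
connection `d + Γ` and the metric `g` satisfy the axioms of the Cartan connection, the vertical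
derivative of `g` is totally symmetric (`g` is a vertical Hessian) and vanishes in the direction
of `y` (`g` is homogeneous of degree zero). A vector `X` is horizontal if `X.2 + Γ(X) y = 0`. -/
structure IsCoordCartan (Ω : Set (E × E)) (Γ : E × E → E × E →L[ℝ] E →L[ℝ] E)
    (g : E × E → E →L[ℝ] E →L[ℝ] ℝ) : Prop where
  isOpen : IsOpen Ω
  contDiffOn_conn : ContDiffOn ℝ ∞ Γ Ω
  contDiffOn_metric : ContDiffOn ℝ ∞ g Ω
  metric_symm : ∀ p ∈ Ω, ∀ a b, g p a b = g p b a
  metric_nondegenerate : ∀ p ∈ Ω, ∀ a, (∀ b, g p a b = 0) → a = 0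
  fderiv_metric_symm : ∀ p ∈ Ω, ∀ v a b, fderiv ℝ g p (0, v) a b = fderiv ℝ g p (0, a) v b
  fderiv_metric_homogeneous : ∀ p ∈ Ω, ∀ a b, fderiv ℝ g p (0, p.2) a b = 0
  metrical : ∀ p ∈ Ω, ∀ X a b, fderiv ℝ g p X a b = g p (Γ p X a) b + g p a (Γ p X b)
  hTorsion : ∀ p ∈ Ω, ∀ X Y : E × E, X.2 + Γ p X p.2 = 0 → Y.2 + Γ p Y p.2 = 0 →
    Γ p X Y.1 = Γ p Y X.1
  hvTorsion : ∀ p ∈ Ω, ∀ v a b, g p (Γ p (0, v) a) b = g p (Γ p (0, v) b) a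

namespace IsCoordCartan

variable {Ω : Set (E × E)} {Γ : E × E → E × E →L[ℝ] E →L[ℝ] E} {g : E × E → E →L[ℝ] E →L[ℝ] ℝ}
  (h : IsCoordCartan Ω Γ g) {p : E × E} (hp : p ∈ Ω)

include h hp

theorem hasFDerivAt_conn : HasFDerivAt Γ (fderiv ℝ Γ p) p :=
  ((h.contDiffOn_conn.contDiffAt (h.isOpen.mem_nhds hp)).differentiableAt (by simp)).hasFDerivAt

/-- The Cartan tensor: `2 g(C(v, a), b)` is the vertical derivative of the metric. -/
theorem two_mul_metric_vertical (v a b : E) :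
    2 * g p (Γ p (0, v) a) b = fderiv ℝ g p (0, v) a b := by
  rw [h.metrical p hp, h.metric_symm p hp a, h.hvTorsion p hp v b a]
  ring

/-- The Cartan tensor `C(v, a) = Γ(0, v) a` is symmetric, because the vertical derivative of the
metric is. -/
theorem vertical_symm (v a : E) : Γ p (0, v) a = Γ p (0, a) v := by
  rw [← sub_eq_zero]
  refine h.metric_nondegenerate p hp _ fun b => ?_
  have h1 := h.two_mul_metric_vertical hp v a b
  have h2 := h.two_mul_metric_vertical hp a v b
  have h3 := h.fderiv_metric_symm p hp v a b
  rw [map_sub, sub_apply]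
  linarith

/-- The Cartan tensor is annihilated by `y`, because the metric is homogeneous of degree zero. -/
theorem vertical_self (v : E) : Γ p (0, v) p.2 = 0 := by
  rw [h.vertical_symm hp]
  refine h.metric_nondegenerate p hp _ fun b => ?_
  have h1 := h.two_mul_metric_vertical hp p.2 v b
  rw [h.fderiv_metric_homogeneous p hp] at h1
  linarith

theorem conn_apply_self (X : E × E) : Γ p X p.2 = Γ p (X.1, 0) p.2 := by
  have : X = (X.1, 0) + (0, X.2) := by simp
  conv_lhs => rw [this, map_add, add_apply, h.vertical_self hp, add_zero]

theorem horizontal_iff (X : E × E) : X.2 + Γ p X p.2 = 0 ↔ X = coordLift Γ p X.1 := by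
  rw [h.conn_apply_self hp, coordLift, Prod.ext_iff]
  simp [eq_neg_iff_add_eq_zero]

theorem conn_coordLift_self (a : E) : Γ p (coordLift Γ p a) p.2 = -(coordLift Γ p a).2 := by
  rw [h.conn_apply_self hp, coordLift, neg_neg]

theorem conn_coordLift_symm (a b : E) : Γ p (coordLift Γ p a) b = Γ p (coordLift Γ p b) a :=
  h.hTorsion p hp (coordLift Γ p a) (coordLift Γ p b)
    ((h.horizontal_iff hp _).2 rfl) ((h.horizontal_iff hp _).2 rfl)

theorem hasFDerivAt_conn_apply (X : E × E) :
    HasFDerivAt (fun q => Γ q X) ((fderiv ℝ Γ p).flip X) p := by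
  simpa using (h.hasFDerivAt_conn hp).clm_apply (hasFDerivAt_const X p)

/-- The derivative of `C(v, y) = 0`. -/
theorem fderiv_vertical_self (X : E × E) (v : E) :
    fderiv ℝ Γ p X (0, v) p.2 + Γ p (0, v) X.2 = 0 := by
  have h2 := (h.hasFDerivAt_conn_apply hp (0, v)).clm_apply (hasFDerivAt_snd (𝕜 := ℝ) (p := p))
  have h3 : (fun q : E × E => Γ q (0, v) q.2) =ᶠ[𝓝 p] fun _ => 0 := by
    filter_upwards [h.isOpen.mem_nhds hp] with q hq using h.vertical_self hq v
  have h4 := (h2.congr_of_eventuallyEq h3.symm).unique (hasFDerivAt_const 0 p)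
  have := congr($h4 X)
  simpa [add_comm] using this

theorem hasFDerivAt_coordLift (a : E) :
    HasFDerivAt (fun q => coordLift Γ q a) ((ContinuousLinearMap.inr ℝ E E).comp
      (-((Γ p (a, 0)).comp (ContinuousLinearMap.snd ℝ E E)
        + ((fderiv ℝ Γ p).flip (a, 0)).flip p.2))) p := by
  have h2 := ((h.hasFDerivAt_conn_apply hp (a, 0)).clm_apply
    (hasFDerivAt_snd (𝕜 := ℝ) (p := p))).neg
  refine ((hasFDerivAt_const a p).prodMk h2).congr_fderiv ?_
  refine ContinuousLinearMap.ext fun X => ?_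
  simp

/-- The derivative of the relation `Γ(La) b = Γ(Lb) a`, which says that the (h)h-torsion
vanishes. -/
theorem fderiv_conn_coordLift_symm (X : E × E) (a b : E) :
    fderiv ℝ Γ p X (coordLift Γ p a) b
        - Γ p (0, fderiv ℝ Γ p X (a, 0) p.2 + Γ p (a, 0) X.2) b
      = fderiv ℝ Γ p X (coordLift Γ p b) a
        - Γ p (0, fderiv ℝ Γ p X (b, 0) p.2 + Γ p (b, 0) X.2) a := by
  have key (a b : E) := (((h.hasFDerivAt_conn hp).clm_apply
    (h.hasFDerivAt_coordLift hp a)).clm_apply (hasFDerivAt_const b p))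
  have h3 : (fun q : E × E => Γ q (coordLift Γ q a) b) =ᶠ[𝓝 p]
      fun q => Γ q (coordLift Γ q b) a := by
    filter_upwards [h.isOpen.mem_nhds hp] with q hq using h.conn_coordLift_symm hq a b
  have h4 := ((key b a).congr_of_eventuallyEq h3).unique (key a b)
  have neg (v c : E) : Γ p (0, -v) c = -Γ p (0, v) c := by
    rw [show ((0, -v) : E × E) = -(0, v) by simp, map_neg, neg_apply]
  have := congr($h4.symm X)
  simp only [add_apply, ContinuousLinearMap.comp_apply,
    ContinuousLinearMap.flip_apply, neg_apply, ContinuousLinearMap.inr_apply,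
    ContinuousLinearMap.coe_snd', zero_apply,
    map_zero, zero_add, neg] at this
  rw [sub_eq_neg_add, sub_eq_neg_add, add_comm (fderiv ℝ Γ p X (a, 0) p.2),
    add_comm (fderiv ℝ Γ p X (b, 0) p.2)]
  exact this

/-- The contracted curvature in terms of the derivatives of the connection coefficients alone. -/
theorem coordCurvature_coordLift_self (a b : E) :
    coordCurvature Γ p (coordLift Γ p a) (coordLift Γ p b) p.2
      = (fderiv ℝ Γ p (coordLift Γ p a) (b, 0) p.2 + Γ p (b, 0) (coordLift Γ p a).2)
        - (fderiv ℝ Γ p (coordLift Γ p b) (a, 0) p.2 + Γ p (a, 0) (coordLift Γ p b).2) := by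
  have split (a : E) : coordLift Γ p a = (a, 0) + (0, (coordLift Γ p a).2) := by simp [coordLift]
  have e1 (X : E × E) (a : E) : fderiv ℝ Γ p X (coordLift Γ p a) p.2
      = fderiv ℝ Γ p X (a, 0) p.2 - Γ p (0, (coordLift Γ p a).2) X.2 := by
    conv_lhs => rw [split a, map_add, add_apply,
      eq_neg_of_add_eq_zero_left (h.fderiv_vertical_self hp X _)]
    abel
  have e2 (a c : E) : Γ p (coordLift Γ p a) c = Γ p (a, 0) c + Γ p (0, (coordLift Γ p a).2) c := by
    conv_lhs => rw [split a, map_add, add_apply]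
  rw [coordCurvature, h.conn_coordLift_self hp, h.conn_coordLift_self hp, map_neg, map_neg,
    e1, e1, e2, e2]
  abel

/-- The first Bianchi identity: the cyclic sum of the h-curvature is the cyclic sum of the Cartan
tensor applied to the contracted curvature. -/
theorem cyclic_coordCurvature (a b c : E) :
    coordCurvature Γ p (coordLift Γ p a) (coordLift Γ p b) c
      + coordCurvature Γ p (coordLift Γ p b) (coordLift Γ p c) a
      + coordCurvature Γ p (coordLift Γ p c) (coordLift Γ p a) b
    = Γ p (0, coordCurvature Γ p (coordLift Γ p a) (coordLift Γ p b) p.2) c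
      + Γ p (0, coordCurvature Γ p (coordLift Γ p b) (coordLift Γ p c) p.2) a
      + Γ p (0, coordCurvature Γ p (coordLift Γ p c) (coordLift Γ p a) p.2) b := by
  have sub (v w c : E) : Γ p (0, v - w) c = Γ p (0, v) c - Γ p (0, w) c := by
    rw [show ((0, v - w) : E × E) = (0, v) - (0, w) by simp, map_sub,
      sub_apply]
  simp only [h.coordCurvature_coordLift_self hp, sub]
  have h1 := h.fderiv_conn_coordLift_symm hp (coordLift Γ p a) b c
  have h2 := h.fderiv_conn_coordLift_symm hp (coordLift Γ p b) c a
  have h3 := h.fderiv_conn_coordLift_symm hp (coordLift Γ p c) a b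
  rw [sub_eq_iff_eq_add] at h1 h2 h3
  simp only [coordCurvature, h1, h2, h3, h.conn_coordLift_symm hp b a,
    h.conn_coordLift_symm hp c a, h.conn_coordLift_symm hp c b]
  abel

theorem hasFDerivAt_metric : HasFDerivAt g (fderiv ℝ g p) p :=
  ((h.contDiffOn_metric.contDiffAt (h.isOpen.mem_nhds hp)).differentiableAt (by simp)).hasFDerivAt

/-- The curvature of a metrical connection is skew-symmetric: differentiate `Dg = 0` once more and
use the symmetry of the second derivative of `g(c, d)` for constant `c`, `d`. -/
theorem coordCurvature_skew (X Y : E × E) (c d : E) :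
    g p (coordCurvature Γ p X Y c) d + g p c (coordCurvature Γ p X Y d) = 0 := by
  set f : E × E → ℝ := fun q => g q c d
  have hfC : ContDiffAt ℝ ∞ f p :=
    ((h.contDiffOn_metric.contDiffAt (h.isOpen.mem_nhds hp)).clm_apply contDiffAt_const).clm_apply
      contDiffAt_const
  have hsymm : IsSymmSndFDerivAt ℝ f p :=
    hfC.isSymmSndFDerivAt (by
      rw [minSmoothness_of_isRCLikeNormedField]; exact WithTop.coe_le_coe.2 le_top)
  have hd2 : HasFDerivAt (fderiv ℝ f) (fderiv ℝ (fderiv ℝ f) p) p :=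
    ((hfC.fderiv_right (m := 1) (WithTop.coe_le_coe.2 le_top)).differentiableAt
      (by simp)).hasFDerivAt
  have hG := h.hasFDerivAt_metric hp
  have hfd (q : E × E) (hq : q ∈ Ω) (Y : E × E) :
      fderiv ℝ f q Y = g q (Γ q Y c) d + g q c (Γ q Y d) := by
    rw [← h.metrical q hq, (((h.hasFDerivAt_metric hq).clm_apply
      (hasFDerivAt_const c q)).clm_apply (hasFDerivAt_const d q)).fderiv]
    simp
  have key (X Y : E × E) : fderiv ℝ (fderiv ℝ f) p X Y
      = fderiv ℝ g p X (Γ p Y c) d + g p (fderiv ℝ Γ p X Y c) d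
        + (fderiv ℝ g p X c (Γ p Y d) + g p c (fderiv ℝ Γ p X Y d)) := by
    have h1 := hd2.clm_apply (hasFDerivAt_const Y p)
    have k1 := (hG.clm_apply ((h.hasFDerivAt_conn_apply hp Y).clm_apply
      (hasFDerivAt_const c p))).clm_apply (hasFDerivAt_const d p)
    have k2 := (hG.clm_apply (hasFDerivAt_const c p)).clm_apply
      ((h.hasFDerivAt_conn_apply hp Y).clm_apply (hasFDerivAt_const d p))
    have h3 : (fun q : E × E => fderiv ℝ f q Y) =ᶠ[𝓝 p]
        fun q => g q (Γ q Y c) d + g q c (Γ q Y d) := by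
      filter_upwards [h.isOpen.mem_nhds hp] with q hq using hfd q hq Y
    have h4 := (h1.congr_of_eventuallyEq h3.symm).unique (k1.add k2)
    have := congr($h4 X)
    simp only [add_apply, ContinuousLinearMap.comp_apply, ContinuousLinearMap.flip_apply,
      zero_apply, map_zero, zero_add] at this
    rw [this]
    abel
  have h1 := key X Y
  have h2 := key Y X
  rw [← hsymm.eq X Y, h1] at h2
  simp only [h.metrical p hp] at h2
  simp only [coordCurvature, map_sub, map_add, sub_apply, add_apply]
  linarith

end IsCoordCartan

end CoordinateCartan

/-- A tensor with the symmetries of a Riemannian curvature tensor is symmetric under the exchange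
of the two pairs of arguments. -/
theorem pair_symm_of_cyclic {α : Type*} {r : α → α → α → α → ℝ}
    (h₁ : ∀ a b c d, r a b c d = -r b a c d) (h₂ : ∀ a b c d, r a b c d = -r a b d c)
    (h₃ : ∀ a b c d, r a b c d + r b c a d + r c a b d = 0) (a b c d : α) :
    r a b c d = r c d a b := by
  linarith [h₃ a b c d, h₃ b c d a, h₃ c d a b, h₃ d a b c, h₁ a b c d, h₁ b c a d, h₁ c a b d,
    h₂ a b c d, h₂ b c a d, h₂ c a b d, h₁ b c d a, h₁ c d b a, h₁ d b c a, h₂ b c d a, h₂ c d b a,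
    h₂ d b c a, h₁ c d a b, h₁ d a c b, h₁ a c d b, h₂ c d a b, h₂ d a c b, h₂ a c d b,
    h₁ d a b c, h₁ a b d c, h₁ b d a c, h₂ d a b c, h₂ a b d c, h₂ b d a c, h₂ c a d b, h₂ b d c a]

/-! ### Sections and vector fields in coordinates -/

section LocalCoordinates

variable {W : Type*} [NormedAddCommGroup W] [NormedSpace ℝ W]
  {H : Type*} [TopologicalSpace H] (I : ModelWithCorners ℝ W H)
  {N : Type*} [TopologicalSpace N] [ChartedSpace H N]
  {G : Type*} [NormedAddCommGroup G] [NormedSpace ℝ G]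
  {V : N → Type*} [TopologicalSpace (TotalSpace G V)] [∀ x, AddCommGroup (V x)]
  [∀ x, Module ℝ (V x)] [∀ x, TopologicalSpace (V x)]
  [FiberBundle G V] [VectorBundle ℝ G V]

variable (G) in
/-- The local representative of a section: its expression in the preferred chart of the base and
the preferred trivialization of the bundle at `z₀`. It is meaningful on `coordDomain`. -/
noncomputable def sectionCoord (z₀ : N) (σ : ∀ z, V z) (p : W) : G :=
  (trivializationAt G V z₀).continuousLinearMapAt ℝ ((extChartAt I z₀).symm p)
    (σ ((extChartAt I z₀).symm p))

variable (G V) in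
/-- The set of points of the chart at `z₀` over which the preferred trivialization at `z₀` is also
defined. -/
def coordDomain (z₀ : N) : Set W :=
  (extChartAt I z₀).target ∩ (extChartAt I z₀).symm ⁻¹' (trivializationAt G V z₀).baseSet

variable {I}

theorem isOpen_coordDomain [I.Boundaryless] (z₀ : N) : IsOpen (coordDomain I G V z₀) :=
  (continuousOn_extChartAt_symm z₀).isOpen_inter_preimage (isOpen_extChartAt_target z₀)
    (trivializationAt G V z₀).open_baseSet

theorem extChartAt_mem_coordDomain {z₀ z : N} (hz : z ∈ (chartAt H z₀).source)
    (hz' : z ∈ (trivializationAt G V z₀).baseSet) : extChartAt I z₀ z ∈ coordDomain I G V z₀ := by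
  rw [← extChartAt_source I] at hz
  exact ⟨(extChartAt I z₀).map_source hz, by rwa [mem_preimage, (extChartAt I z₀).left_inv hz]⟩

theorem sectionCoord_extChartAt {z₀ z : N} (hz : z ∈ (chartAt H z₀).source) (σ : ∀ z, V z) :
    sectionCoord I G z₀ σ (extChartAt I z₀ z)
      = (trivializationAt G V z₀).continuousLinearMapAt ℝ z (σ z) := by
  rw [← extChartAt_source I] at hz
  exact congrArg (fun w => (trivializationAt G V z₀).continuousLinearMapAt ℝ w (σ w))
    ((extChartAt I z₀).left_inv hz)

theorem snd_trivializationAt_eq {z₀ z : N} (hz' : z ∈ (trivializationAt G V z₀).baseSet)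
    (v : V z) : (trivializationAt G V z₀ ⟨z, v⟩).2
      = (trivializationAt G V z₀).continuousLinearMapAt ℝ z v := by
  rw [Trivialization.continuousLinearMapAt_apply, Trivialization.linearMapAt_apply, if_pos hz']

theorem continuousLinearMapAt_injective {z₀ z : N} (hz' : z ∈ (trivializationAt G V z₀).baseSet) :
    Function.Injective ((trivializationAt G V z₀).continuousLinearMapAt ℝ z) := by
  intro v w h
  rw [← (trivializationAt G V z₀).symmL_continuousLinearMapAt hz' (R := ℝ) v, h,
    (trivializationAt G V z₀).symmL_continuousLinearMapAt hz']

theorem mdifferentiableAt_iff_comp_extChartAt_symm [I.Boundaryless] [IsManifold I 1 N] {z₀ z : N}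
    (hz : z ∈ (chartAt H z₀).source) {f : N → G} :
    MDifferentiableAt I 𝓘(ℝ, G) f z
      ↔ DifferentiableAt ℝ (f ∘ (extChartAt I z₀).symm) (extChartAt I z₀ z) := by
  have hz2 := hz
  rw [← extChartAt_source I] at hz
  rw [← mdifferentiableAt_iff_differentiableAt]
  constructor
  · intro h
    have h1 := mdifferentiableWithinAt_extChartAt_symm ((extChartAt I z₀).map_source hz)
    rw [I.range_eq_univ, mdifferentiableWithinAt_univ] at h1
    refine MDifferentiableAt.comp _ ?_ h1
    rwa [(extChartAt I z₀).left_inv hz]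
  · intro h
    refine (h.comp z (mdifferentiableAt_extChartAt hz2)).congr_of_eventuallyEq ?_
    filter_upwards [extChartAt_source_mem_nhds' hz] with w hw
    exact congrArg f ((extChartAt I z₀).left_inv hw).symm

theorem mvfderiv_eq_fderiv_comp [I.Boundaryless] [IsManifold I 1 N] {z₀ z : N}
    (hz : z ∈ (chartAt H z₀).source) {f : N → G} (hf : MDifferentiableAt I 𝓘(ℝ, G) f z)
    (X : TangentSpace I z) :
    mvfderiv I f z X = fderiv ℝ (f ∘ (extChartAt I z₀).symm) (extChartAt I z₀ z)
      ((trivializationAt W (TangentSpace I) z₀).continuousLinearMapAt ℝ z X) := by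
  have h1 := (mdifferentiableAt_iff_comp_extChartAt_symm hz).1 hf
  rw [TangentBundle.continuousLinearMapAt_trivializationAt hz]
  have h2 : f =ᶠ[𝓝 z] (f ∘ (extChartAt I z₀).symm) ∘ extChartAt I z₀ := by
    rw [← extChartAt_source I] at hz
    filter_upwards [extChartAt_source_mem_nhds' hz] with w hw
    exact congrArg f ((extChartAt I z₀).left_inv hw).symm
  change mfderiv I 𝓘(ℝ, G) f z X = _
  rw [h2.mfderiv_eq, mfderiv_comp z h1.mdifferentiableAt (mdifferentiableAt_extChartAt hz),
    mfderiv_eq_fderiv]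
  rfl

theorem mdifferentiableAt_section_iff_sectionCoord [I.Boundaryless] [IsManifold I 1 N]
    [ContMDiffVectorBundle 1 G V I] {z₀ z : N}
    (hz : z ∈ (chartAt H z₀).source) (hz' : z ∈ (trivializationAt G V z₀).baseSet)
    (σ : ∀ z, V z) :
    MDifferentiableAt I (I.prod 𝓘(ℝ, G)) (fun w => (⟨w, σ w⟩ : TotalSpace G V)) z
      ↔ DifferentiableAt ℝ (sectionCoord I G z₀ σ) (extChartAt I z₀ z) := by
  rw [(trivializationAt G V z₀).mdifferentiableAt_section_iff I σ hz',
    mdifferentiableAt_iff_comp_extChartAt_symm hz]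
  refine Filter.EventuallyEq.differentiableAt_iff ?_
  filter_upwards [(isOpen_coordDomain z₀).mem_nhds (extChartAt_mem_coordDomain hz hz')] with p hp
  exact snd_trivializationAt_eq hp.2 _

theorem contDiffAt_sectionCoord [I.Boundaryless] {n : WithTop ℕ∞} [IsManifold I n N]
    [ContMDiffVectorBundle n G V I] {z₀ z : N}
    (hz : z ∈ (chartAt H z₀).source) (hz' : z ∈ (trivializationAt G V z₀).baseSet)
    {σ : ∀ z, V z}
    (hσ : ContMDiffAt I (I.prod 𝓘(ℝ, G)) n (fun w => (⟨w, σ w⟩ : TotalSpace G V)) z) :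
    ContDiffAt ℝ n (sectionCoord I G z₀ σ) (extChartAt I z₀ z) := by
  have h1 := ((trivializationAt G V z₀).contMDiffAt_section_iff hz').1 hσ
  have hz2 := hz
  rw [← extChartAt_source I] at hz
  have h2 : ContMDiffAt 𝓘(ℝ, W) I n (extChartAt I z₀).symm (extChartAt I z₀ z) :=
    (contMDiffOn_extChartAt_symm z₀).contMDiffAt (extChartAt_target_mem_nhds'
      ((extChartAt I z₀).map_source hz))
  have h3 := ContMDiffAt.comp (extChartAt I z₀ z) (by rwa [(extChartAt I z₀).left_inv hz]) h2
  refine (contMDiffAt_iff_contDiffAt.1 h3).congr_of_eventuallyEq ?_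
  filter_upwards [(isOpen_coordDomain z₀).mem_nhds (extChartAt_mem_coordDomain hz2 hz')] with p hp
  exact (snd_trivializationAt_eq hp.2 _).symm

theorem sectionCoord_mlieBracket [CompleteSpace W] [I.Boundaryless] [IsManifold I ∞ N] {z₀ z : N}
    (hz : z ∈ (chartAt H z₀).source) {X Y : ∀ z : N, TangentSpace I z}
    (hX : MDifferentiableAt I I.tangent (fun w => (⟨w, X w⟩ : TangentBundle I N)) z)
    (hY : MDifferentiableAt I I.tangent (fun w => (⟨w, Y w⟩ : TangentBundle I N)) z) :
    (trivializationAt W (TangentSpace I) z₀).continuousLinearMapAt ℝ z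
        (VectorField.mlieBracket I X Y z)
      = VectorField.lieBracket ℝ (sectionCoord I W z₀ X) (sectionCoord I W z₀ Y)
          (extChartAt I z₀ z) := by
  have hz2 := hz
  rw [← extChartAt_source I] at hz
  have ht := (extChartAt I z₀).map_source hz
  have hsm : ContMDiffAt 𝓘(ℝ, W) I ∞ (extChartAt I z₀).symm (extChartAt I z₀ z) :=
    (contMDiffOn_extChartAt_symm z₀).contMDiffAt (extChartAt_target_mem_nhds' ht)
  have hpull (Z : ∀ z : N, TangentSpace I z) {p : W} (hp : p ∈ (extChartAt I z₀).target) :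
      VectorField.mpullback 𝓘(ℝ, W) I (extChartAt I z₀).symm Z p = sectionCoord I W z₀ Z p := by
    have hp2 : (extChartAt I z₀).symm p ∈ (chartAt H z₀).source := by
      rw [← extChartAt_source I]; exact (extChartAt I z₀).map_target hp
    rw [VectorField.mpullback_apply, sectionCoord,
      TangentBundle.continuousLinearMapAt_trivializationAt hp2]
    have h1 := mfderiv_extChartAt_comp_mfderivWithin_extChartAt_symm (I := I) hp
    have h2 := mfderivWithin_extChartAt_symm_comp_mfderiv_extChartAt (I := I) hp
    rw [I.range_eq_univ, mfderivWithin_univ] at h1 h2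
    rw [ContinuousLinearMap.inverse_eq h2 h1]
    rfl
  have : IsManifold I (minSmoothness ℝ 2) N := by
    rw [minSmoothness_of_isRCLikeNormedField]; infer_instance
  have key := VectorField.mpullback_mlieBracket (I := 𝓘(ℝ, W)) (I' := I) (n := ∞)
    (f := (extChartAt I z₀).symm) (x₀ := extChartAt I z₀ z) (V := X) (W := Y)
    (by rwa [(extChartAt I z₀).left_inv hz]) (by rwa [(extChartAt I z₀).left_inv hz]) hsm
    (by rw [minSmoothness_of_isRCLikeNormedField]; exact WithTop.coe_le_coe.2 le_top)
  rw [hpull _ ht, sectionCoord_extChartAt hz2] at key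
  have hflat (A B : W → W) (q : W) :
      VectorField.mlieBracket 𝓘(ℝ, W) A B q = VectorField.lieBracket ℝ A B q :=
    (congrFun (VectorField.mlieBracketWithin_eq_lieBracketWithin (V := A) (W := B) (s := univ))
      q).trans (congrFun VectorField.lieBracketWithin_univ q)
  have hcongr (Z : ∀ z : N, TangentSpace I z) :
      (VectorField.mpullback 𝓘(ℝ, W) I (extChartAt I z₀).symm Z : W → W)
        =ᶠ[𝓝 (extChartAt I z₀ z)] sectionCoord I W z₀ Z := by
    filter_upwards [extChartAt_target_mem_nhds' ht] with p hp using hpull _ hp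
  exact (key.trans (hflat _ _ _)).trans ((hcongr X).lieBracket_vectorField_eq (hcongr Y))

end LocalCoordinates

/-! ### Christoffel symbols of a linear connection -/

section Christoffel

variable {W : Type*} [NormedAddCommGroup W] [NormedSpace ℝ W]
  {H : Type*} [TopologicalSpace H] {I : ModelWithCorners ℝ W H} [I.Boundaryless]
  {N : Type*} [TopologicalSpace N] [ChartedSpace H N] [IsManifold I ∞ N]
  {G : Type*} [NormedAddCommGroup G] [NormedSpace ℝ G] [FiniteDimensional ℝ G]
  {V : N → Type*} [TopologicalSpace (TotalSpace G V)] [∀ x, AddCommGroup (V x)]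
  [∀ x, Module ℝ (V x)] [∀ x, TopologicalSpace (V x)]
  [∀ x, IsTopologicalAddGroup (V x)] [∀ x, ContinuousSMul ℝ (V x)]
  [FiberBundle G V] [VectorBundle ℝ G V] [ContMDiffVectorBundle ∞ G V I]
  (D : CovariantDerivative I G V)

variable (G) in
/-- The section that is constant, equal to `c`, in the preferred trivialization at `z₀`. -/
noncomputable def constSection (z₀ : N) (c : G) (z : N) : V z :=
  (trivializationAt G V z₀).symmL ℝ z c

theorem contMDiffOn_constSection (z₀ : N) (c : G) :
    ContMDiffOn I (I.prod 𝓘(ℝ, G)) ∞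
      (fun w => (⟨w, constSection G z₀ c w⟩ : TotalSpace G V))
      (trivializationAt G V z₀).baseSet := by
  rw [(trivializationAt G V z₀).contMDiffOn_section_baseSet_iff]
  refine (contMDiffOn_const (c := c)).congr fun w hw => ?_
  rw [snd_trivializationAt_eq hw, constSection,
    (trivializationAt G V z₀).continuousLinearMapAt_symmL hw]

theorem mdifferentiableAt_constSection {z₀ z : N} (hz' : z ∈ (trivializationAt G V z₀).baseSet)
    (c : G) : MDifferentiableAt I (I.prod 𝓘(ℝ, G))
      (fun w => (⟨w, constSection G z₀ c w⟩ : TotalSpace G V)) z :=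
  ((contMDiffOn_constSection z₀ c).contMDiffAt
    ((trivializationAt G V z₀).open_baseSet.mem_nhds hz')).mdifferentiableAt (by simp)

/-- The Christoffel symbols of a linear connection near `z₀`, in the preferred chart and
trivialization: `Γ(X) c = ∑ cⁱ D_X eᵢ` for the sections `eᵢ` that are constant in the
trivialization. -/
noncomputable def christoffel (z₀ : N) (p : W) : W →L[ℝ] G →L[ℝ] G :=
  ∑ i, (ContinuousLinearMap.smulRightL ℝ G G
    (LinearMap.toContinuousLinearMap ((Module.finBasis ℝ G).coord i))).comp
      (ContinuousLinearMap.inCoordinates W (TangentSpace I) G V z₀ ((extChartAt I z₀).symm p)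
        z₀ ((extChartAt I z₀).symm p)
        (D (constSection G z₀ (Module.finBasis ℝ G i)) ((extChartAt I z₀).symm p)))

theorem contDiffOn_christoffel (z₀ : N)
    (hD : ContMDiffCovariantDerivativeOn G ∞ D (trivializationAt G V z₀).baseSet) :
    ContDiffOn ℝ ∞ (christoffel D z₀) (coordDomain I G V z₀) := by
  unfold christoffel
  refine ContDiffOn.sum fun i _ => contDiffOn_const.clm_comp ?_
  have hbase {w : N} (hw : w ∈ (chartAt H z₀).source)
      (hw' : w ∈ (trivializationAt G V z₀).baseSet) :
      w ∈ (trivializationAt (W →L[ℝ] G) (fun x => TangentSpace I x →L[ℝ] V x) z₀).baseSet := by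
    rw [hom_trivializationAt_baseSet]; exact ⟨hw, hw'⟩
  have h1 := hD.contMDiff (contMDiffOn_constSection (I := I) z₀ (Module.finBasis ℝ G i))
  intro p hp
  have hp2 : (extChartAt I z₀).symm p ∈ (chartAt H z₀).source := by
    rw [← extChartAt_source I]; exact (extChartAt I z₀).map_target hp.1
  have h2 := h1.contMDiffAt ((trivializationAt G V z₀).open_baseSet.mem_nhds hp.2)
  have h3 := contDiffAt_sectionCoord (z₀ := z₀) (G := W →L[ℝ] G) hp2 (hbase hp2 hp.2) h2
  rw [(extChartAt I z₀).right_inv hp.1] at h3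
  refine (h3.congr_of_eventuallyEq ?_).contDiffWithinAt
  filter_upwards [(isOpen_coordDomain z₀).mem_nhds hp] with q hq
  have hq2 : (extChartAt I z₀).symm q ∈ (chartAt H z₀).source := by
    rw [← extChartAt_source I]; exact (extChartAt I z₀).map_target hq.1
  rw [sectionCoord, ← snd_trivializationAt_eq (hbase hq2 hq.2)]
  rfl

omit [I.Boundaryless] [FiniteDimensional ℝ G] [ContMDiffVectorBundle ∞ G V I] in
theorem covariantDerivative_sum {z : N} {ι : Type*} (s : Finset ι) (f : ι → N → ℝ)
    (σ : ι → ∀ w, V w) (hf : ∀ i, MDifferentiableAt I 𝓘(ℝ) (f i) z)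
    (hσ : ∀ i, MDifferentiableAt I (I.prod 𝓘(ℝ, G))
      (fun w => (⟨w, σ i w⟩ : TotalSpace G V)) z) (X : TangentSpace I z) :
    D (∑ i ∈ s, f i • σ i) z X
      = ∑ i ∈ s, (f i z • D (σ i) z X + mvfderiv I (f i) z X • σ i z) := by
  classical
  induction s using Finset.induction_on with
  | empty => simp
  | insert i s hi ih =>
    have hsm (i : ι) : MDifferentiableAt I (I.prod 𝓘(ℝ, G))
        (fun w => (⟨w, (f i • σ i) w⟩ : TotalSpace G V)) z := (hf i).smul_section (hσ i)
    have hsum : MDifferentiableAt I (I.prod 𝓘(ℝ, G))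
        (fun w => (⟨w, (∑ i ∈ s, f i • σ i) w⟩ : TotalSpace G V)) z := by
      have := MDifferentiableAt.sum_section (s := s) fun i _ => hsm i
      simpa only [Finset.sum_apply] using this
    rw [Finset.sum_insert hi, Finset.sum_insert hi,
      D.isCovariantDerivativeOnUniv.add (hsm i) hsum,
      D.isCovariantDerivativeOnUniv.leibniz (hσ i) (hf i), add_apply, ih, add_apply]
    rfl

/-- A linear connection is `d + Γ` in coordinates: expand the section in the frame of the sections
that are constant in the trivialization and apply the Leibniz rule. -/
theorem covariantDerivative_coord {z₀ z : N} (hz : z ∈ (chartAt H z₀).source)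
    (hz' : z ∈ (trivializationAt G V z₀).baseSet) {σ : ∀ z, V z}
    (hσ : MDifferentiableAt I (I.prod 𝓘(ℝ, G)) (fun w => (⟨w, σ w⟩ : TotalSpace G V)) z)
    (X : TangentSpace I z) :
    (trivializationAt G V z₀).continuousLinearMapAt ℝ z (D σ z X)
      = fderiv ℝ (sectionCoord I G z₀ σ) (extChartAt I z₀ z)
          ((trivializationAt W (TangentSpace I) z₀).continuousLinearMapAt ℝ z X)
        + christoffel D z₀ (extChartAt I z₀ z)
          ((trivializationAt W (TangentSpace I) z₀).continuousLinearMapAt ℝ z X)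
          ((trivializationAt G V z₀).continuousLinearMapAt ℝ z (σ z)) := by
  set e := trivializationAt G V z₀
  set b := Module.finBasis ℝ G
  set f : Fin (Module.finrank ℝ G) → N → ℝ := fun i w =>
    b.coord i (e.continuousLinearMapAt ℝ w (σ w)) with hf
  have hσ' := (mdifferentiableAt_section_iff_sectionCoord hz hz' σ).1 hσ
  have hfc (i) : f i ∘ (extChartAt I z₀).symm
      = (LinearMap.toContinuousLinearMap (b.coord i)) ∘ sectionCoord I G z₀ σ := rfl
  have hfd (i) : MDifferentiableAt I 𝓘(ℝ) (f i) z := by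
    rw [mdifferentiableAt_iff_comp_extChartAt_symm hz, hfc]
    exact (ContinuousLinearMap.differentiableAt _).comp _ hσ'
  have hsum : D σ z = D (∑ i, f i • constSection G z₀ (b i)) z := by
    refine D.isCovariantDerivativeOnUniv.congr_of_eventuallyEq hσ ?_ Filter.univ_mem ?_
    · have := MDifferentiableAt.sum_section (s := Finset.univ) fun i _ =>
        (hfd i).smul_section (mdifferentiableAt_constSection (I := I) hz' (b i))
      simpa only [Finset.sum_apply] using this
    · filter_upwards [e.open_baseSet.mem_nhds hz'] with w hw
      rw [Finset.sum_apply]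
      apply continuousLinearMapAt_injective hw
      rw [map_sum]
      conv_lhs => rw [← b.sum_repr (e.continuousLinearMapAt ℝ w (σ w))]
      refine Finset.sum_congr rfl fun i _ => ?_
      rw [Pi.smul_apply', map_smul, constSection, e.continuousLinearMapAt_symmL hw]
      rfl
  rw [hsum, covariantDerivative_sum D _ _ _ hfd
    fun i => mdifferentiableAt_constSection (I := I) hz' (b i), map_sum]
  have hX : (trivializationAt W (TangentSpace I) z₀).symmL ℝ z
      ((trivializationAt W (TangentSpace I) z₀).continuousLinearMapAt ℝ z X) = X :=
    (trivializationAt W (TangentSpace I) z₀).symmL_continuousLinearMapAt hz X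
  have hchr : christoffel D z₀ (extChartAt I z₀ z)
      = ∑ i, (ContinuousLinearMap.smulRightL ℝ G G
    (LinearMap.toContinuousLinearMap (b.coord i))).comp
      (ContinuousLinearMap.inCoordinates W (TangentSpace I) G V z₀ z z₀ z
        (D (constSection G z₀ (b i)) z)) := by
    have := (extChartAt I z₀).left_inv (by rwa [extChartAt_source])
    unfold christoffel
    rw [this]
  have hder : fderiv ℝ (sectionCoord I G z₀ σ) (extChartAt I z₀ z)
      ((trivializationAt W (TangentSpace I) z₀).continuousLinearMapAt ℝ z X)
      = ∑ i, mvfderiv I (f i) z X • b i := by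
    conv_lhs => rw [← b.sum_repr (fderiv ℝ (sectionCoord I G z₀ σ) (extChartAt I z₀ z)
      ((trivializationAt W (TangentSpace I) z₀).continuousLinearMapAt ℝ z X))]
    refine Finset.sum_congr rfl fun i _ => ?_
    rw [mvfderiv_eq_fderiv_comp hz (hfd i), hfc,
      fderiv_comp _ (ContinuousLinearMap.differentiableAt _) hσ', ContinuousLinearMap.fderiv]
    rfl
  rw [hder, hchr, sum_apply, sum_apply,
    ← Finset.sum_add_distrib]
  refine Finset.sum_congr rfl fun i _ => ?_
  rw [map_add, map_smul, map_smul, constSection, e.continuousLinearMapAt_symmL hz', add_comm]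
  congr 1
  simp only [ContinuousLinearMap.inCoordinates, ContinuousLinearMap.comp_apply, hX]
  rfl

end Christoffel

/-! ### The curvature of a linear connection in coordinates -/

section Curvature

variable {W : Type*} [NormedAddCommGroup W] [NormedSpace ℝ W] [CompleteSpace W]
  {H : Type*} [TopologicalSpace H] {I : ModelWithCorners ℝ W H} [I.Boundaryless]
  {N : Type*} [TopologicalSpace N] [ChartedSpace H N] [IsManifold I ∞ N]
  {G : Type*} [NormedAddCommGroup G] [NormedSpace ℝ G] [FiniteDimensional ℝ G]
  {V : N → Type*} [TopologicalSpace (TotalSpace G V)] [∀ x, AddCommGroup (V x)]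
  [∀ x, Module ℝ (V x)] [∀ x, TopologicalSpace (V x)]
  [∀ x, IsTopologicalAddGroup (V x)] [∀ x, ContinuousSMul ℝ (V x)]
  [FiberBundle G V] [VectorBundle ℝ G V] [ContMDiffVectorBundle ∞ G V I]
  (D : CovariantDerivative I G V)

theorem eventually_sectionCoord_covariantDerivative {z₀ z : N} (hz : z ∈ (chartAt H z₀).source)
    (hz' : z ∈ (trivializationAt G V z₀).baseSet) {σ : ∀ z, V z}
    (hσ : ContMDiffAt I (I.prod 𝓘(ℝ, G)) 2 (fun w => (⟨w, σ w⟩ : TotalSpace G V)) z)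
    (Y : ∀ z : N, TangentSpace I z) :
    sectionCoord I G z₀ (fun w => D σ w (Y w)) =ᶠ[𝓝 (extChartAt I z₀ z)]
      fun q => fderiv ℝ (sectionCoord I G z₀ σ) q (sectionCoord I W z₀ Y q)
        + christoffel D z₀ q (sectionCoord I W z₀ Y q) (sectionCoord I G z₀ σ q) := by
  have hz2 := hz
  rw [← extChartAt_source I] at hz
  have hev : ∀ᶠ w in 𝓝 z,
      MDifferentiableAt I (I.prod 𝓘(ℝ, G)) (fun w => (⟨w, σ w⟩ : TotalSpace G V)) w := by
    filter_upwards [(contMDiffAt_iff_contMDiffAt_nhds (by simp)).1 hσ] with w hw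
      using hw.mdifferentiableAt (by simp)
  have hcont : Filter.Tendsto (extChartAt I z₀).symm (𝓝 (extChartAt I z₀ z)) (𝓝 z) := by
    have h := (continuousAt_extChartAt_symm'' (I := I) ((extChartAt I z₀).map_source hz)).tendsto
    rwa [(extChartAt I z₀).left_inv hz] at h
  filter_upwards [hcont.eventually hev,
    (isOpen_coordDomain z₀).mem_nhds (extChartAt_mem_coordDomain hz2 hz')] with q hq hq'
  have hq2 : (extChartAt I z₀).symm q ∈ (chartAt H z₀).source := by
    rw [← extChartAt_source I]; exact (extChartAt I z₀).map_target hq'.1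
  have h := covariantDerivative_coord D hq2 hq'.2 hq (Y ((extChartAt I z₀).symm q))
  rw [(extChartAt I z₀).right_inv hq'.1] at h
  exact h

/-- The curvature of a linear connection is that of `d + Γ` in coordinates. In particular it is
tensorial, although it is written with vector fields and sections. -/
theorem curvature_coord {z₀ z : N} (hz : z ∈ (chartAt H z₀).source)
    (hz' : z ∈ (trivializationAt G V z₀).baseSet)
    (hD : ContMDiffCovariantDerivativeOn G ∞ D (trivializationAt G V z₀).baseSet)
    {X Y : ∀ z : N, TangentSpace I z}
    (hX : MDifferentiableAt I I.tangent (fun w => (⟨w, X w⟩ : TangentBundle I N)) z)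
    (hY : MDifferentiableAt I I.tangent (fun w => (⟨w, Y w⟩ : TangentBundle I N)) z)
    {σ : ∀ z, V z}
    (hσ : ContMDiffAt I (I.prod 𝓘(ℝ, G)) 2 (fun w => (⟨w, σ w⟩ : TotalSpace G V)) z) :
    (trivializationAt G V z₀).continuousLinearMapAt ℝ z
        (D (fun w => D σ w (Y w)) z (X z) - D (fun w => D σ w (X w)) z (Y z)
          - D σ z (VectorField.mlieBracket I X Y z))
      = coordCurvature (christoffel D z₀) (extChartAt I z₀ z)
          ((trivializationAt W (TangentSpace I) z₀).continuousLinearMapAt ℝ z (X z))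
          ((trivializationAt W (TangentSpace I) z₀).continuousLinearMapAt ℝ z (Y z))
          ((trivializationAt G V z₀).continuousLinearMapAt ℝ z (σ z)) := by
  have hz2 := extChartAt_mem_coordDomain (I := I) hz hz'
  have hΓ : HasFDerivAt (christoffel D z₀) _ (extChartAt I z₀ z) :=
    (((contDiffOn_christoffel D z₀ hD).contDiffAt
      ((isOpen_coordDomain z₀).mem_nhds hz2)).differentiableAt (by simp)).hasFDerivAt
  have hσc := contDiffAt_sectionCoord hz hz' hσ
  have hσ1 : HasFDerivAt (sectionCoord I G z₀ σ) _ (extChartAt I z₀ z) :=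
    (hσc.differentiableAt (by simp)).hasFDerivAt
  have hσ2 : HasFDerivAt (fderiv ℝ (sectionCoord I G z₀ σ)) _ (extChartAt I z₀ z) :=
    ((hσc.fderiv_right (m := 1) (by norm_num)).differentiableAt (by simp)).hasFDerivAt
  have hsymm : IsSymmSndFDerivAt ℝ (sectionCoord I G z₀ σ) (extChartAt I z₀ z) :=
    hσc.isSymmSndFDerivAt (by rw [minSmoothness_of_isRCLikeNormedField])
  have hvf {Y : ∀ z : N, TangentSpace I z}
      (hY : MDifferentiableAt I I.tangent (fun w => (⟨w, Y w⟩ : TangentBundle I N)) z) :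
      HasFDerivAt (sectionCoord I W z₀ Y) (fderiv ℝ (sectionCoord I W z₀ Y) (extChartAt I z₀ z))
        (extChartAt I z₀ z) :=
    ((mdifferentiableAt_section_iff_sectionCoord (G := W) hz hz Y).1 hY).hasFDerivAt
  have key {X Y : ∀ z : N, TangentSpace I z}
      (hY : MDifferentiableAt I I.tangent (fun w => (⟨w, Y w⟩ : TangentBundle I N)) z) :
      (trivializationAt G V z₀).continuousLinearMapAt ℝ z (D (fun w => D σ w (Y w)) z (X z))
      = fderiv ℝ (fderiv ℝ (sectionCoord I G z₀ σ)) (extChartAt I z₀ z)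
          (sectionCoord I W z₀ X (extChartAt I z₀ z)) (sectionCoord I W z₀ Y (extChartAt I z₀ z))
        + fderiv ℝ (sectionCoord I G z₀ σ) (extChartAt I z₀ z)
          (fderiv ℝ (sectionCoord I W z₀ Y) (extChartAt I z₀ z)
            (sectionCoord I W z₀ X (extChartAt I z₀ z)))
        + fderiv ℝ (christoffel D z₀) (extChartAt I z₀ z)
          (sectionCoord I W z₀ X (extChartAt I z₀ z)) (sectionCoord I W z₀ Y (extChartAt I z₀ z))
          (sectionCoord I G z₀ σ (extChartAt I z₀ z))
        + christoffel D z₀ (extChartAt I z₀ z)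
          (fderiv ℝ (sectionCoord I W z₀ Y) (extChartAt I z₀ z)
            (sectionCoord I W z₀ X (extChartAt I z₀ z)))
          (sectionCoord I G z₀ σ (extChartAt I z₀ z))
        + christoffel D z₀ (extChartAt I z₀ z) (sectionCoord I W z₀ Y (extChartAt I z₀ z))
          (fderiv ℝ (sectionCoord I G z₀ σ) (extChartAt I z₀ z)
            (sectionCoord I W z₀ X (extChartAt I z₀ z)))
        + christoffel D z₀ (extChartAt I z₀ z) (sectionCoord I W z₀ X (extChartAt I z₀ z))
          (fderiv ℝ (sectionCoord I G z₀ σ) (extChartAt I z₀ z)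
            (sectionCoord I W z₀ Y (extChartAt I z₀ z))
          + christoffel D z₀ (extChartAt I z₀ z) (sectionCoord I W z₀ Y (extChartAt I z₀ z))
            (sectionCoord I G z₀ σ (extChartAt I z₀ z))) := by
    have hev := eventually_sectionCoord_covariantDerivative D hz hz' hσ Y
    have hder := ((hσ2.clm_apply (hvf hY)).add
      ((hΓ.clm_apply (hvf hY)).clm_apply hσ1)).congr_of_eventuallyEq hev
    have hdiff := (mdifferentiableAt_section_iff_sectionCoord (I := I) (G := G) (V := V) hz hz'
      (fun w => D σ w (Y w))).2 hder.differentiableAt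
    have h := covariantDerivative_coord D hz hz' hdiff (X z)
    rw [← sectionCoord_extChartAt (I := I) hz (fun w => D σ w (Y w)), hev.self_of_nhds,
      hder.fderiv, ← sectionCoord_extChartAt (I := I) hz X] at h
    rw [h]
    simp only [add_apply, ContinuousLinearMap.comp_apply, ContinuousLinearMap.flip_apply]
    abel
  -- The derivative terms of `X`, `Y` are cancelled by the bracket, and the second derivatives of
  -- `σ` by their symmetry.
  have hbr := covariantDerivative_coord D hz hz' (hσ.mdifferentiableAt (by simp))
    (VectorField.mlieBracket I X Y z)
  rw [sectionCoord_mlieBracket hz hX hY, VectorField.lieBracket, map_sub, map_sub, sub_apply,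
    ← sectionCoord_extChartAt (I := I) hz σ] at hbr
  rw [map_sub, map_sub, key hY, key hX, hbr, ← sectionCoord_extChartAt (I := I) hz X,
    ← sectionCoord_extChartAt (I := I) hz Y, ← sectionCoord_extChartAt (I := I) hz σ,
    coordCurvature, hsymm.eq (sectionCoord I W z₀ X (extChartAt I z₀ z)), map_add, map_add]
  abel

end Curvature

/-! ### The pullback bundle in coordinates -/

section PullbackCoordinates

variable {E : Type*} [NormedAddCommGroup E] [NormedSpace ℝ E]
  {M : Type*} [TopologicalSpace M] [ChartedSpace E M] [IsManifold 𝓘(ℝ, E) ∞ M]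
  {A : Opens (TangentBundle 𝓘(ℝ, E) M)}

theorem mem_chartAt_source_iff {z₀ z : A} :
    z ∈ (chartAt (ModelProd E E) z₀).source ↔ z.1.proj ∈ (chartAt E z₀.1.proj).source := by
  rw [Opens.chartAt_eq, OpenPartialHomeomorph.subtypeRestr_source]
  exact TangentBundle.mem_chart_source_iff _ _

theorem mem_baseSet_piFiber_iff {z₀ z : A} :
    z ∈ (trivializationAt E (PiFiber A) z₀).baseSet ↔ z.1.proj ∈ (chartAt E z₀.1.proj).source :=
  Iff.rfl

theorem extChartAt_eq {z₀ z : A} : extChartAt 𝓘(ℝ, E).tangent z₀ z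
    = (extChartAt 𝓘(ℝ, E) z₀.1.proj z.1.proj,
      (trivializationAt E (TangentSpace 𝓘(ℝ, E)) z₀.1.proj z.1).2) := rfl

theorem continuousLinearMapAt_piFiber {z₀ z : A} (v : PiFiber A z) :
    (trivializationAt E (PiFiber A) z₀).continuousLinearMapAt ℝ z v
      = (trivializationAt E (TangentSpace 𝓘(ℝ, E)) z₀.1.proj).continuousLinearMapAt ℝ z.1.proj v :=
  rfl

theorem continuousLinearMapAt_eta {z₀ z : A} (hz : z ∈ (chartAt (ModelProd E E) z₀).source) :
    (trivializationAt E (PiFiber A) z₀).continuousLinearMapAt ℝ z (eta A z)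
      = (extChartAt 𝓘(ℝ, E).tangent z₀ z).2 := by
  rw [extChartAt_eq]
  exact (snd_trivializationAt_eq (mem_chartAt_source_iff.1 hz) z.1.2).symm

theorem continuousLinearMapAt_piStar {z₀ z : A} (hz : z ∈ (chartAt (ModelProd E E) z₀).source)
    (X : TangentSpace 𝓘(ℝ, E).tangent z) :
    (trivializationAt E (PiFiber A) z₀).continuousLinearMapAt ℝ z (piStar A z X)
      = ((trivializationAt (E × E) (TangentSpace 𝓘(ℝ, E).tangent) z₀).continuousLinearMapAt ℝ z
          X).1 := by
  have hz' := mem_chartAt_source_iff.1 hz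
  rw [continuousLinearMapAt_piFiber, TangentBundle.continuousLinearMapAt_trivializationAt hz,
    TangentBundle.continuousLinearMapAt_trivializationAt hz', piStar]
  have h1 : (extChartAt 𝓘(ℝ, E) z₀.1.proj) ∘ (footMap A : A → M)
      = (ContinuousLinearMap.fst ℝ E E) ∘ (extChartAt 𝓘(ℝ, E).tangent z₀) := rfl
  have h2 := mfderiv_comp z (mdifferentiableAt_extChartAt hz')
    ((footMap A).contMDiff.mdifferentiableAt (by simp))
  have h3 := mfderiv_comp z (ContinuousLinearMap.fst ℝ E E).mdifferentiableAt
    (mdifferentiableAt_extChartAt (I := 𝓘(ℝ, E).tangent) hz)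
  rw [h1, h3, ContinuousLinearMap.mfderiv_eq] at h2
  exact congr($h2.symm X)

variable (A) in
theorem sectionCoord_eta {z₀ : A} {p : E × E}
    (hp : p ∈ (extChartAt 𝓘(ℝ, E).tangent z₀).target) :
    sectionCoord 𝓘(ℝ, E).tangent E z₀ (eta A) p = p.2 := by
  have hp2 : (extChartAt 𝓘(ℝ, E).tangent z₀).symm p ∈ (chartAt (ModelProd E E) z₀).source := by
    rw [← extChartAt_source 𝓘(ℝ, E).tangent]
    exact (extChartAt 𝓘(ℝ, E).tangent z₀).map_target hp
  rw [sectionCoord, continuousLinearMapAt_eta hp2,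
    (extChartAt 𝓘(ℝ, E).tangent z₀).right_inv hp]

theorem sectionCoord_piStar {z₀ : A} (Y : ∀ z : A, TangentSpace 𝓘(ℝ, E).tangent z) {p : E × E}
    (hp : p ∈ (extChartAt 𝓘(ℝ, E).tangent z₀).target) :
    sectionCoord 𝓘(ℝ, E).tangent E z₀ (fun w => piStar A w (Y w)) p
      = (sectionCoord 𝓘(ℝ, E).tangent (E × E) z₀ Y p).1 := by
  have hp2 : (extChartAt 𝓘(ℝ, E).tangent z₀).symm p ∈ (chartAt (ModelProd E E) z₀).source := by
    rw [← extChartAt_source 𝓘(ℝ, E).tangent]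
    exact (extChartAt 𝓘(ℝ, E).tangent z₀).map_target hp
  rw [sectionCoord, continuousLinearMapAt_piStar hp2]
  rfl

/-- The fundamental section is smooth, since in the preferred chart it is the second coordinate. -/
theorem contMDiff_eta : ContMDiff 𝓘(ℝ, E).tangent (𝓘(ℝ, E).tangent.prod 𝓘(ℝ, E)) ∞
    (fun w => (⟨w, eta A w⟩ : TotalSpace E (PiFiber A))) := by
  intro z
  rw [(trivializationAt E (PiFiber A) z).contMDiffAt_section_iff
    (mem_baseSet_trivializationAt E (PiFiber A) z)]
  have h := ((contMDiffOn_extChartAt (I := 𝓘(ℝ, E).tangent) (n := ∞) (x := z)).contMDiffAt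
    ((chartAt (ModelProd E E) z).open_source.mem_nhds (mem_chart_source _ z)))
  exact (ContinuousLinearMap.snd ℝ E E).contMDiff.contMDiffAt.comp z h

variable [FiniteDimensional ℝ E] (D : PiConnection A)

theorem mem_verticalSpace_iff {z₀ z : A} (hz : z ∈ (chartAt (ModelProd E E) z₀).source)
    (X : TangentSpace 𝓘(ℝ, E).tangent z) :
    X ∈ verticalSpace A z ↔ ((trivializationAt (E × E)
      (TangentSpace 𝓘(ℝ, E).tangent) z₀).continuousLinearMapAt ℝ z X).1 = 0 := by
  rw [← continuousLinearMapAt_piStar hz, verticalSpace, LinearMap.mem_ker,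
    ← map_eq_zero_iff _ (continuousLinearMapAt_injective (mem_baseSet_piFiber_iff.2
      (mem_chartAt_source_iff.1 hz)))]
  rfl

/-- In coordinates `D_X η = X.2 + Γ(X) y`. -/
theorem covariantDerivative_eta_coord {z₀ z : A} (hz : z ∈ (chartAt (ModelProd E E) z₀).source)
    (X : TangentSpace 𝓘(ℝ, E).tangent z) :
    (trivializationAt E (PiFiber A) z₀).continuousLinearMapAt ℝ z (D (eta A) z X)
      = ((trivializationAt (E × E)
          (TangentSpace 𝓘(ℝ, E).tangent) z₀).continuousLinearMapAt ℝ z X).2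
        + christoffel D z₀ (extChartAt 𝓘(ℝ, E).tangent z₀ z)
          ((trivializationAt (E × E)
            (TangentSpace 𝓘(ℝ, E).tangent) z₀).continuousLinearMapAt ℝ z X)
          (extChartAt 𝓘(ℝ, E).tangent z₀ z).2 := by
  have hz' : z ∈ (trivializationAt E (PiFiber A) z₀).baseSet := mem_chartAt_source_iff.1 hz
  have hev : sectionCoord 𝓘(ℝ, E).tangent E z₀ (eta A)
      =ᶠ[𝓝 (extChartAt 𝓘(ℝ, E).tangent z₀ z)] Prod.snd := by
    filter_upwards [extChartAt_target_mem_nhds' ((extChartAt 𝓘(ℝ, E).tangent z₀).map_source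
      (by rwa [extChartAt_source]))] with p hp using sectionCoord_eta A hp
  rw [covariantDerivative_coord D hz hz' (contMDiff_eta.mdifferentiableAt (by simp)),
    continuousLinearMapAt_eta hz, hev.fderiv_eq, fderiv_snd]
  rfl

theorem mem_horizontalSpace_iff {z₀ z : A} (hz : z ∈ (chartAt (ModelProd E E) z₀).source)
    (X : TangentSpace 𝓘(ℝ, E).tangent z) :
    X ∈ horizontalSpace D z ↔
      ((trivializationAt (E × E)
          (TangentSpace 𝓘(ℝ, E).tangent) z₀).continuousLinearMapAt ℝ z X).2
        + christoffel D z₀ (extChartAt 𝓘(ℝ, E).tangent z₀ z)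
          ((trivializationAt (E × E)
            (TangentSpace 𝓘(ℝ, E).tangent) z₀).continuousLinearMapAt ℝ z X)
          (extChartAt 𝓘(ℝ, E).tangent z₀ z).2 = 0 := by
  rw [← covariantDerivative_eta_coord D hz, horizontalSpace, LinearMap.mem_ker,
    map_eq_zero_iff _ (continuousLinearMapAt_injective (mem_baseSet_piFiber_iff.2
      (mem_chartAt_source_iff.1 hz)))]
  rfl

theorem torsionField_coord {z₀ z : A} (hz : z ∈ (chartAt (ModelProd E E) z₀).source)
    {X Y : ∀ z : A, TangentSpace 𝓘(ℝ, E).tangent z}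
    (hX : MDifferentiableAt 𝓘(ℝ, E).tangent 𝓘(ℝ, E).tangent.tangent
      (fun w => (⟨w, X w⟩ : TangentBundle 𝓘(ℝ, E).tangent A)) z)
    (hY : MDifferentiableAt 𝓘(ℝ, E).tangent 𝓘(ℝ, E).tangent.tangent
      (fun w => (⟨w, Y w⟩ : TangentBundle 𝓘(ℝ, E).tangent A)) z) :
    (trivializationAt E (PiFiber A) z₀).continuousLinearMapAt ℝ z (torsionField D X Y z)
      = christoffel D z₀ (extChartAt 𝓘(ℝ, E).tangent z₀ z)
          ((trivializationAt (E × E)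
            (TangentSpace 𝓘(ℝ, E).tangent) z₀).continuousLinearMapAt ℝ z (X z))
          ((trivializationAt (E × E)
            (TangentSpace 𝓘(ℝ, E).tangent) z₀).continuousLinearMapAt ℝ z (Y z)).1
        - christoffel D z₀ (extChartAt 𝓘(ℝ, E).tangent z₀ z)
          ((trivializationAt (E × E)
            (TangentSpace 𝓘(ℝ, E).tangent) z₀).continuousLinearMapAt ℝ z (Y z))
          ((trivializationAt (E × E)
            (TangentSpace 𝓘(ℝ, E).tangent) z₀).continuousLinearMapAt ℝ z (X z)).1 := by
  have hz' : z ∈ (trivializationAt E (PiFiber A) z₀).baseSet := mem_chartAt_source_iff.1 hz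
  have hvf {Y : ∀ z : A, TangentSpace 𝓘(ℝ, E).tangent z}
      (hY : MDifferentiableAt 𝓘(ℝ, E).tangent 𝓘(ℝ, E).tangent.tangent
        (fun w => (⟨w, Y w⟩ : TangentBundle 𝓘(ℝ, E).tangent A)) z) :
      HasFDerivAt (sectionCoord 𝓘(ℝ, E).tangent (E × E) z₀ Y)
        (fderiv ℝ (sectionCoord 𝓘(ℝ, E).tangent (E × E) z₀ Y)
          (extChartAt 𝓘(ℝ, E).tangent z₀ z)) (extChartAt 𝓘(ℝ, E).tangent z₀ z) :=
    ((mdifferentiableAt_section_iff_sectionCoord (G := E × E) hz hz Y).1 hY).hasFDerivAt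
  have key {X Y : ∀ z : A, TangentSpace 𝓘(ℝ, E).tangent z}
      (hY : MDifferentiableAt 𝓘(ℝ, E).tangent 𝓘(ℝ, E).tangent.tangent
        (fun w => (⟨w, Y w⟩ : TangentBundle 𝓘(ℝ, E).tangent A)) z) :
      (trivializationAt E (PiFiber A) z₀).continuousLinearMapAt ℝ z
        (D (fun w => piStar A w (Y w)) z (X z))
      = (fderiv ℝ (sectionCoord 𝓘(ℝ, E).tangent (E × E) z₀ Y)
          (extChartAt 𝓘(ℝ, E).tangent z₀ z)
          (sectionCoord 𝓘(ℝ, E).tangent (E × E) z₀ X (extChartAt 𝓘(ℝ, E).tangent z₀ z))).1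
        + christoffel D z₀ (extChartAt 𝓘(ℝ, E).tangent z₀ z)
          ((trivializationAt (E × E)
            (TangentSpace 𝓘(ℝ, E).tangent) z₀).continuousLinearMapAt ℝ z (X z))
          ((trivializationAt (E × E)
            (TangentSpace 𝓘(ℝ, E).tangent) z₀).continuousLinearMapAt ℝ z (Y z)).1 := by
    have hev : sectionCoord 𝓘(ℝ, E).tangent E z₀ (fun w => piStar A w (Y w))
        =ᶠ[𝓝 (extChartAt 𝓘(ℝ, E).tangent z₀ z)]
          fun q => (sectionCoord 𝓘(ℝ, E).tangent (E × E) z₀ Y q).1 := by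
      filter_upwards [extChartAt_target_mem_nhds' ((extChartAt 𝓘(ℝ, E).tangent z₀).map_source
        (by rwa [extChartAt_source]))] with p hp using sectionCoord_piStar Y hp
    have hder := (hvf hY).fst.congr_of_eventuallyEq hev
    have hdiff := (mdifferentiableAt_section_iff_sectionCoord (I := 𝓘(ℝ, E).tangent) (G := E)
      hz hz' (fun w => piStar A w (Y w))).2 hder.differentiableAt
    rw [covariantDerivative_coord D hz hz' hdiff (X z), hder.fderiv,
      continuousLinearMapAt_piStar hz, ← sectionCoord_extChartAt (I := 𝓘(ℝ, E).tangent) hz X]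
    rfl
  rw [torsionField, map_sub, map_sub, key hX, key hY, continuousLinearMapAt_piStar hz,
    sectionCoord_mlieBracket hz hX hY, VectorField.lieBracket, Prod.fst_sub]
  abel

theorem torsion_coord {z₀ z : A} (hz : z ∈ (chartAt (ModelProd E E) z₀).source)
    (u v : TangentSpace 𝓘(ℝ, E).tangent z) :
    (trivializationAt E (PiFiber A) z₀).continuousLinearMapAt ℝ z (torsion D z u v)
      = christoffel D z₀ (extChartAt 𝓘(ℝ, E).tangent z₀ z)
          ((trivializationAt (E × E)
            (TangentSpace 𝓘(ℝ, E).tangent) z₀).continuousLinearMapAt ℝ z u)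
          ((trivializationAt (E × E)
            (TangentSpace 𝓘(ℝ, E).tangent) z₀).continuousLinearMapAt ℝ z v).1
        - christoffel D z₀ (extChartAt 𝓘(ℝ, E).tangent z₀ z)
          ((trivializationAt (E × E)
            (TangentSpace 𝓘(ℝ, E).tangent) z₀).continuousLinearMapAt ℝ z v)
          ((trivializationAt (E × E)
            (TangentSpace 𝓘(ℝ, E).tangent) z₀).continuousLinearMapAt ℝ z u).1 := by
  rw [torsion, torsionField_coord D hz (FiberBundle.mdifferentiableAt_extend _ _ u)
    (FiberBundle.mdifferentiableAt_extend _ _ v), FiberBundle.extend_apply_self,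
    FiberBundle.extend_apply_self]

theorem curvature_eq_coord {z₀ z : A} (hz : z ∈ (chartAt (ModelProd E E) z₀).source)
    (hD : ContMDiffCovariantDerivativeOn E ∞ D (trivializationAt E (PiFiber A) z₀).baseSet)
    (u v : TangentSpace 𝓘(ℝ, E).tangent z) (c : PiFiber A z) :
    (trivializationAt E (PiFiber A) z₀).continuousLinearMapAt ℝ z (curvature D z u v c)
      = coordCurvature (christoffel D z₀) (extChartAt 𝓘(ℝ, E).tangent z₀ z)
          ((trivializationAt (E × E)
            (TangentSpace 𝓘(ℝ, E).tangent) z₀).continuousLinearMapAt ℝ z u)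
          ((trivializationAt (E × E)
            (TangentSpace 𝓘(ℝ, E).tangent) z₀).continuousLinearMapAt ℝ z v)
          ((trivializationAt E (PiFiber A) z₀).continuousLinearMapAt ℝ z c) := by
  have h := curvature_coord D hz (mem_chartAt_source_iff.1 hz) hD
    (FiberBundle.mdifferentiableAt_extend _ _ u) (FiberBundle.mdifferentiableAt_extend _ _ v)
    (FiberBundle.contMDiffAt_extend (k := 2) 𝓘(ℝ, E).tangent E c)
  simp only [FiberBundle.extend_apply_self] at h
  rw [← h]
  simp only [curvature, curvatureField, FiberBundle.extend_apply_self]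

end PullbackCoordinates

/-! ### Vertical Hessians -/

section MetricCoordinates

set_option synthInstance.maxHeartbeats 100000

variable {E : Type*} [NormedAddCommGroup E] [NormedSpace ℝ E]

/-- The second derivative of `f` in the second variable. -/
noncomputable def vertHessian (f : E × E → ℝ) (p : E × E) : E →L[ℝ] E →L[ℝ] ℝ :=
  (fderiv ℝ (fderiv ℝ f) p).bilinearComp (ContinuousLinearMap.inr ℝ E E)
    (ContinuousLinearMap.inr ℝ E E)

theorem vertHessian_apply (f : E × E → ℝ) (p : E × E) (a b : E) :
    vertHessian f p a b = fderiv ℝ (fderiv ℝ f) p (0, a) (0, b) := rfl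

theorem contDiffOn_vertHessian [FiniteDimensional ℝ E] {f : E × E → ℝ} {Ω : Set (E × E)}
    (hΩ : IsOpen Ω) (hf : ContDiffOn ℝ ∞ f Ω) : ContDiffOn ℝ ∞ (vertHessian f) Ω := by
  have h1 : ContDiffOn ℝ ∞ (fderiv ℝ f) Ω := hf.fderiv_of_isOpen hΩ (by simp)
  have h2 : ContDiffOn ℝ ∞ (fderiv ℝ (fderiv ℝ f)) Ω := h1.fderiv_of_isOpen hΩ (by simp)
  rw [contDiffOn_clm_apply]
  intro a
  rw [contDiffOn_clm_apply]
  intro b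
  exact (h2.clm_apply contDiffOn_const).clm_apply contDiffOn_const

theorem vertHessian_symm {f : E × E → ℝ} {p : E × E} (hf : ContDiffAt ℝ ∞ f p) (a b : E) :
    vertHessian f p a b = vertHessian f p b a :=
  (hf.isSymmSndFDerivAt (by
    rw [minSmoothness_of_isRCLikeNormedField]; exact WithTop.coe_le_coe.2 le_top)).eq _ _

theorem hasFDerivAt_fderiv {F : Type*} [NormedAddCommGroup F] [NormedSpace ℝ F]
    {f : E × E → F} {p : E × E} (hf : ContDiffAt ℝ ∞ f p) :
    HasFDerivAt (fderiv ℝ f) (fderiv ℝ (fderiv ℝ f) p) p :=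
  ((hf.fderiv_right (m := 1) (WithTop.coe_le_coe.2 le_top)).differentiableAt
    (by simp)).hasFDerivAt

theorem fderiv_vertHessian [FiniteDimensional ℝ E] {f : E × E → ℝ} {p : E × E}
    {Ω : Set (E × E)} (hΩ : IsOpen Ω) (hf : ContDiffOn ℝ ∞ f Ω) (hp : p ∈ Ω) (X : E × E) (a b : E) :
    fderiv ℝ (vertHessian f) p X a b
      = fderiv ℝ (fderiv ℝ (fderiv ℝ f)) p X (0, a) (0, b) := by
  have h0 : HasFDerivAt (vertHessian f) (fderiv ℝ (vertHessian f) p) p :=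
    (((contDiffOn_vertHessian hΩ hf).contDiffAt (hΩ.mem_nhds hp)).differentiableAt
      (by simp)).hasFDerivAt
  have h1 : ContDiffAt ℝ ∞ (fderiv ℝ f) p :=
    (hf.contDiffAt (hΩ.mem_nhds hp)).fderiv_right (by simp)
  have h2 := ((hasFDerivAt_fderiv h1).clm_apply (hasFDerivAt_const (0, a) p)).clm_apply
    (hasFDerivAt_const (0, b) p)
  have h3 := (h0.clm_apply (hasFDerivAt_const a p)).clm_apply (hasFDerivAt_const b p)
  have := congr($(h3.unique h2) X)
  simpa using this

/-- The third vertical derivatives of a smooth function are totally symmetric. -/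
theorem fderiv_vertHessian_symm [FiniteDimensional ℝ E] {f : E × E → ℝ} {p : E × E}
    {Ω : Set (E × E)} (hΩ : IsOpen Ω) (hf : ContDiffOn ℝ ∞ f Ω) (hp : p ∈ Ω) (v a b : E) :
    fderiv ℝ (vertHessian f) p (0, v) a b = fderiv ℝ (vertHessian f) p (0, a) v b := by
  have h1 : ContDiffAt ℝ ∞ (fderiv ℝ f) p :=
    (hf.contDiffAt (hΩ.mem_nhds hp)).fderiv_right (by simp)
  have hs : IsSymmSndFDerivAt ℝ (fderiv ℝ f) p := h1.isSymmSndFDerivAt (by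
    rw [minSmoothness_of_isRCLikeNormedField]; exact WithTop.coe_le_coe.2 le_top)
  rw [fderiv_vertHessian hΩ hf hp, fderiv_vertHessian hΩ hf hp, hs.eq]

theorem fderiv_fderiv_comp_affine {f : E × E → ℝ} {x : E} {L : E →L[ℝ] E} {u : E}
    (hf : ContDiffAt ℝ ∞ f (x, L u)) (a b : E) :
    fderiv ℝ (fderiv ℝ fun w => f (x, L w)) u a b = vertHessian f (x, L u) (L a) (L b) := by
  have hJ (w : E) : HasFDerivAt (fun w => (x, L w)) ((0 : E →L[ℝ] E).prod L) w :=
    (hasFDerivAt_const x w).prodMk L.hasFDerivAt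
  have hev : ∀ᶠ w in 𝓝 u, DifferentiableAt ℝ f (x, L w) := by
    have h1 : ∀ᶠ q in 𝓝 (x, L u), ContDiffAt ℝ 1 f q :=
      (hf.of_le (WithTop.coe_le_coe.2 le_top)).eventually (by simp)
    exact ((hJ u).continuousAt.tendsto.eventually h1).mono fun w hw =>
      hw.differentiableAt (by simp)
  have hfd : (fderiv ℝ fun w => f (x, L w))
      =ᶠ[𝓝 u] fun w => (fderiv ℝ f (x, L w)).comp ((0 : E →L[ℝ] E).prod L) := by
    filter_upwards [hev] with w hw
    exact (hw.hasFDerivAt.comp w (hJ w)).fderiv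
  have h2 := ((hasFDerivAt_fderiv hf).comp u (hJ u)).clm_comp
    (hasFDerivAt_const ((0 : E →L[ℝ] E).prod L) u)
  rw [(h2.congr_of_eventuallyEq hfd).fderiv]
  simp [vertHessian_apply]

/-- The Hessian of a function that is homogeneous of degree two is homogeneous of degree zero. -/
theorem fderiv_fderiv_smul_of_homogeneous {h : E → ℝ} {u : E} {t : ℝ} (ht : t ≠ 0)
    (hh : ∀ᶠ w in 𝓝 u, h (t • w) = t ^ 2 * h w) :
    fderiv ℝ (fderiv ℝ h) (t • u) = fderiv ℝ (fderiv ℝ h) u := by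
  have h1 : (fun w => fderiv ℝ h (t • w)) =ᶠ[𝓝 u] fun w => t • fderiv ℝ h w := by
    have h2 : (fun w => h (t • w)) =ᶠ[𝓝 u] (t ^ 2) • h := hh
    filter_upwards [h2.fderiv (𝕜 := ℝ)] with w hw
    rw [fderiv_comp_smul, fderiv_const_smul_field, pow_two, mul_smul] at hw
    exact (smul_right_injective _ ht) hw
  have h3 : fderiv ℝ (fun w => fderiv ℝ h (t • w)) u = t • fderiv ℝ (fderiv ℝ h) (t • u) :=
    fderiv_comp_smul t
  have h4 : fderiv ℝ (fun w => t • fderiv ℝ h w) u = t • fderiv ℝ (fderiv ℝ h) u :=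
    congrFun (fderiv_const_smul_field (𝕜 := ℝ) (f := fderiv ℝ h) t) u
  exact (smul_right_injective _ ht) (h3.symm.trans (h1.fderiv_eq.trans h4))

theorem fderiv_vertHessian_self_of_homogeneous [FiniteDimensional ℝ E] {f : E × E → ℝ} {p : E × E}
    {Ω : Set (E × E)} (hΩ : IsOpen Ω) (hf : ContDiffOn ℝ ∞ f Ω) (hp : p ∈ Ω)
    (hh : ∀ q ∈ Ω, ∀ t : ℝ, 0 < t → f (q.1, t • q.2) = t ^ 2 * f q) (a b : E) :
    fderiv ℝ (vertHessian f) p (0, p.2) a b = 0 := by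
  have h0 : HasFDerivAt (vertHessian f) (fderiv ℝ (vertHessian f) p) p :=
    (((contDiffOn_vertHessian hΩ hf).contDiffAt (hΩ.mem_nhds hp)).differentiableAt
      (by simp)).hasFDerivAt
  have hH := (h0.clm_apply (hasFDerivAt_const a p)).clm_apply (hasFDerivAt_const b p)
  have hγ : HasDerivAt (fun t : ℝ => (p.1, t • p.2)) (0, p.2) 1 := by
    have := (hasDerivAt_const (1 : ℝ) p.1).prodMk ((hasDerivAt_id (1 : ℝ)).smul_const p.2)
    simpa using this
  have h1 := HasFDerivAt.comp_hasDerivAt_of_eq (1 : ℝ) hH hγ (by simp)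
  have hconst : ((fun q => vertHessian f q a b) ∘ fun t : ℝ => (p.1, t • p.2))
      =ᶠ[𝓝 1] fun _ => vertHessian f p a b := by
    have hev : ∀ᶠ t : ℝ in 𝓝 1, (p.1, t • p.2) ∈ Ω := by
      refine hγ.continuousAt.tendsto.eventually (hΩ.mem_nhds ?_)
      simpa using hp
    filter_upwards [hev, eventually_gt_nhds (zero_lt_one' ℝ)] with t ht ht0
    have hev2 : ∀ᶠ w in 𝓝 p.2, (p.1, w) ∈ Ω :=
      (Continuous.prodMk_right p.1).continuousAt.tendsto.eventually (hΩ.mem_nhds hp)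
    have h2 := fderiv_fderiv_smul_of_homogeneous (h := fun w => f (p.1, w)) ht0.ne'
      (hev2.mono fun w hw => hh _ hw t ht0)
    have k1 := fderiv_fderiv_comp_affine (L := .id ℝ E) (x := p.1) (u := t • p.2)
      (hf.contDiffAt (hΩ.mem_nhds ht)) a b
    have k2 := fderiv_fderiv_comp_affine (L := .id ℝ E) (x := p.1) (u := p.2)
      (hf.contDiffAt (hΩ.mem_nhds hp)) a b
    exact k1.symm.trans (congr($h2 a b).trans k2)
  have h2 := (h1.congr_of_eventuallyEq hconst.symm).unique (hasDerivAt_const (1 : ℝ) _)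
  simpa using h2

end MetricCoordinates

/-! ### The Cartan connection satisfies the coordinate axioms -/

section CartanCoordinates

set_option synthInstance.maxHeartbeats 100000

variable {E : Type*} [NormedAddCommGroup E] [NormedSpace ℝ E]
  {M : Type*} [TopologicalSpace M] [ChartedSpace E M] [IsManifold 𝓘(ℝ, E) ∞ M]
  {A : Opens (TangentBundle 𝓘(ℝ, E) M)} {F : TangentBundle 𝓘(ℝ, E) M → ℝ}

theorem mem_coordDomain_piFiber {z₀ z : A} (hz : z ∈ (chartAt (ModelProd E E) z₀).source) :
    extChartAt 𝓘(ℝ, E).tangent z₀ z ∈ coordDomain 𝓘(ℝ, E).tangent E (PiFiber A) z₀ :=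
  extChartAt_mem_coordDomain hz (mem_chartAt_source_iff.1 hz)

theorem exists_extChartAt_eq {z₀ : A} {p : E × E}
    (hp : p ∈ coordDomain 𝓘(ℝ, E).tangent E (PiFiber A) z₀) :
    ∃ z ∈ (chartAt (ModelProd E E) z₀).source, extChartAt 𝓘(ℝ, E).tangent z₀ z = p := by
  refine ⟨(extChartAt 𝓘(ℝ, E).tangent z₀).symm p, ?_, (extChartAt _ z₀).right_inv hp.1⟩
  rw [← extChartAt_source 𝓘(ℝ, E).tangent]
  exact (extChartAt _ z₀).map_target hp.1

/-- The energy `F² / 2` in the chart of the tangent bundle at `z₀`. -/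
noncomputable def coordEnergy (F : TangentBundle 𝓘(ℝ, E) M → ℝ) (z₀ : A) (p : E × E) : ℝ :=
  F ((extChartAt 𝓘(ℝ, E).tangent z₀.1).symm p) ^ 2 / 2

theorem coordEnergy_apply {z₀ z : A} (hz : z ∈ (chartAt (ModelProd E E) z₀).source) (u : E) :
    coordEnergy F z₀ ((extChartAt 𝓘(ℝ, E).tangent z₀ z).1,
      (trivializationAt E (TangentSpace 𝓘(ℝ, E)) z₀.1.proj).continuousLinearMapAt ℝ z.1.proj u)
      = F ⟨z.1.proj, u⟩ ^ 2 / 2 := by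
  have h1 : extChartAt 𝓘(ℝ, E).tangent z₀.1 ⟨z.1.proj, u⟩
      = ((extChartAt 𝓘(ℝ, E).tangent z₀ z).1,
        (trivializationAt E (TangentSpace 𝓘(ℝ, E)) z₀.1.proj).continuousLinearMapAt ℝ
          z.1.proj u) := by
    exact Prod.ext rfl (snd_trivializationAt_eq (V := TangentSpace 𝓘(ℝ, E)) (z₀ := z₀.1.proj)
      (z := z.1.proj) (mem_chartAt_source_iff.1 hz) u)
  have h2 : (⟨z.1.proj, u⟩ : TangentBundle 𝓘(ℝ, E) M)
      ∈ (extChartAt 𝓘(ℝ, E).tangent z₀.1).source := by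
    rw [extChartAt_source]
    exact (TangentBundle.mem_chart_source_iff _ _).2 (mem_chartAt_source_iff.1 hz)
  rw [coordEnergy, ← h1, (extChartAt 𝓘(ℝ, E).tangent z₀.1).left_inv h2]

theorem extChartAt_snd_eq {z₀ z : A} (hz : z ∈ (chartAt (ModelProd E E) z₀).source) :
    (extChartAt 𝓘(ℝ, E).tangent z₀ z).2
      = (trivializationAt E (TangentSpace 𝓘(ℝ, E)) z₀.1.proj).continuousLinearMapAt ℝ z.1.proj
        z.1.snd :=
  (continuousLinearMapAt_eta hz).symm

theorem contDiffOn_coordEnergy (hF : IsFinslerFunction F A) (z₀ : A) :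
    ContDiffOn ℝ ∞ (coordEnergy F z₀) (coordDomain 𝓘(ℝ, E).tangent E (PiFiber A) z₀) := by
  intro p hp
  obtain ⟨z, hz, rfl⟩ := exists_extChartAt_eq hp
  have h0 : z.1 ∈ (extChartAt 𝓘(ℝ, E).tangent z₀.1).source := by
    rw [extChartAt_source]
    exact (TangentBundle.mem_chart_source_iff _ _).2 (mem_chartAt_source_iff.1 hz)
  have h1 : ContMDiffAt 𝓘(ℝ, E × E) 𝓘(ℝ, E).tangent ∞ (extChartAt 𝓘(ℝ, E).tangent z₀.1).symm
      (extChartAt 𝓘(ℝ, E).tangent z₀.1 z.1) :=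
    (contMDiffOn_extChartAt_symm z₀.1).contMDiffAt (extChartAt_target_mem_nhds'
      ((extChartAt 𝓘(ℝ, E).tangent z₀.1).map_source h0))
  have h2 : ContMDiffAt 𝓘(ℝ, E).tangent 𝓘(ℝ) ∞ F z.1 :=
    hF.smooth.contMDiffAt (A.2.mem_nhds z.2)
  rw [← (extChartAt 𝓘(ℝ, E).tangent z₀.1).left_inv h0] at h2
  have h3 := contMDiffAt_iff_contDiffAt.1 (h2.comp _ h1)
  exact ((h3.pow 2).div_const 2).contDiffWithinAt

theorem coordEnergy_smul (hF : IsFinslerFunction F A) {z₀ : A} {p : E × E}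
    (hp : p ∈ coordDomain 𝓘(ℝ, E).tangent E (PiFiber A) z₀) {t : ℝ} (ht : 0 < t) :
    coordEnergy F z₀ (p.1, t • p.2) = t ^ 2 * coordEnergy F z₀ p := by
  obtain ⟨z, hz, rfl⟩ := exists_extChartAt_eq hp
  have h1 := coordEnergy_apply (F := F) hz (t • z.1.snd)
  have h2 := coordEnergy_apply (F := F) hz z.1.snd
  rw [← extChartAt_snd_eq hz, Prod.mk.eta] at h2
  rw [map_smul, ← extChartAt_snd_eq hz] at h1
  rw [h1, h2, hF.homogeneous z.1 z.2 t ht]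
  ring

/-- The Finsler metric is the vertical Hessian of the energy in coordinates: on a fibre the chart of
the tangent bundle is a linear map. -/
theorem finslerMetric_coord (hF : IsFinslerFunction F A) {z₀ z : A}
    (hz : z ∈ (chartAt (ModelProd E E) z₀).source) (a b : PiFiber A z) :
    finslerMetric F A z a b = vertHessian (coordEnergy F z₀) (extChartAt 𝓘(ℝ, E).tangent z₀ z)
      ((trivializationAt E (PiFiber A) z₀).continuousLinearMapAt ℝ z a)
      ((trivializationAt E (PiFiber A) z₀).continuousLinearMapAt ℝ z b) := by
  have hp := mem_coordDomain_piFiber hz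
  have h1 := (contDiffOn_coordEnergy hF z₀).contDiffAt ((isOpen_coordDomain z₀).mem_nhds hp)
  let L : E →L[ℝ] E := (trivializationAt E (TangentSpace 𝓘(ℝ, E))
    z₀.1.proj).continuousLinearMapAt ℝ z.1.proj
  have h0 : ((extChartAt 𝓘(ℝ, E).tangent z₀ z).1, L z.1.snd)
      = extChartAt 𝓘(ℝ, E).tangent z₀ z := Prod.ext rfl (extChartAt_snd_eq hz).symm
  rw [← h0] at h1
  have h2 := fderiv_fderiv_comp_affine (L := L) h1 a b
  have hfun : (fun w : E => coordEnergy F z₀ ((extChartAt 𝓘(ℝ, E).tangent z₀ z).1, L w))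
      = fun u => F ⟨z.1.proj, u⟩ ^ 2 / 2 := funext (coordEnergy_apply (F := F) hz)
  rw [hfun, h0] at h2
  exact h2

theorem sectionCoord_constSection {z₀ : A} (c : E) {p : E × E}
    (hp : p ∈ coordDomain 𝓘(ℝ, E).tangent E (PiFiber A) z₀) :
    sectionCoord 𝓘(ℝ, E).tangent E z₀ (constSection E z₀ c : ∀ z, PiFiber A z) p = c :=
  (trivializationAt E (PiFiber A) z₀).continuousLinearMapAt_symmL hp.2 c

theorem continuousLinearMapAt_symmL_tangent {z₀ z : A}
    (hz : z ∈ (chartAt (ModelProd E E) z₀).source) (X : E × E) :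
    (trivializationAt (E × E) (TangentSpace 𝓘(ℝ, E).tangent) z₀).continuousLinearMapAt ℝ z
      ((trivializationAt (E × E) (TangentSpace 𝓘(ℝ, E).tangent) z₀).symmL ℝ z X) = X :=
  (trivializationAt (E × E) (TangentSpace 𝓘(ℝ, E).tangent) z₀).continuousLinearMapAt_symmL hz X

theorem finslerMetric_add_left (hF : IsFinslerFunction F A) (z : A) (a b c : PiFiber A z) :
    finslerMetric F A z (a + b) c = finslerMetric F A z a c + finslerMetric F A z b c := by
  have hz : z ∈ (chartAt (ModelProd E E) z).source := mem_chart_source _ z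
  simp only [finslerMetric_coord hF hz, map_add, add_apply]

theorem finslerMetric_neg_left (hF : IsFinslerFunction F A) (z : A) (a c : PiFiber A z) :
    finslerMetric F A z (-a) c = -finslerMetric F A z a c := by
  have hz : z ∈ (chartAt (ModelProd E E) z).source := mem_chart_source _ z
  simp only [finslerMetric_coord hF hz, map_neg, neg_apply]

theorem finslerMetric_zero_left (hF : IsFinslerFunction F A) (z : A) (c : PiFiber A z) :
    finslerMetric F A z 0 c = 0 := by
  have hz : z ∈ (chartAt (ModelProd E E) z).source := mem_chart_source _ z
  simp only [finslerMetric_coord hF hz, map_zero, zero_apply]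

theorem finslerMetric_constSection (hF : IsFinslerFunction F A) {z₀ z : A}
    (hz : z ∈ (chartAt (ModelProd E E) z₀).source) (a b : E) :
    finslerMetric F A z (constSection E z₀ a z) (constSection E z₀ b z)
      = vertHessian (coordEnergy F z₀) (extChartAt 𝓘(ℝ, E).tangent z₀ z) a b := by
  have hz' : z ∈ (trivializationAt E (PiFiber A) z₀).baseSet := mem_chartAt_source_iff.1 hz
  rw [finslerMetric_coord hF hz, constSection, constSection,
    (trivializationAt E (PiFiber A) z₀).continuousLinearMapAt_symmL hz',
    (trivializationAt E (PiFiber A) z₀).continuousLinearMapAt_symmL hz']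

theorem coord_metric_nondegenerate (hF : IsFinslerFunction F A) {z₀ z : A}
    (hz : z ∈ (chartAt (ModelProd E E) z₀).source) {a : E}
    (h : ∀ b, vertHessian (coordEnergy F z₀) (extChartAt 𝓘(ℝ, E).tangent z₀ z) a b = 0) :
    a = 0 := by
  have hz' : z ∈ (trivializationAt E (PiFiber A) z₀).baseSet := mem_chartAt_source_iff.1 hz
  have h1 := hF.nondegenerate z ((trivializationAt E (PiFiber A) z₀).symmL ℝ z a) fun b => by
    rw [finslerMetric_coord hF hz,
      (trivializationAt E (PiFiber A) z₀).continuousLinearMapAt_symmL hz']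
    exact h _
  rw [← (trivializationAt E (PiFiber A) z₀).continuousLinearMapAt_symmL hz' a (R := ℝ), h1,
    map_zero]

variable [FiniteDimensional ℝ E] {D : PiConnection A}

theorem covariantDerivative_constSection_coord {z₀ z : A}
    (hz : z ∈ (chartAt (ModelProd E E) z₀).source) (X : TangentSpace 𝓘(ℝ, E).tangent z) (c : E) :
    (trivializationAt E (PiFiber A) z₀).continuousLinearMapAt ℝ z (D (constSection E z₀ c) z X)
      = christoffel D z₀ (extChartAt 𝓘(ℝ, E).tangent z₀ z)
        ((trivializationAt (E × E) (TangentSpace 𝓘(ℝ, E).tangent) z₀).continuousLinearMapAt ℝ z X)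
        c := by
  have hz' : z ∈ (trivializationAt E (PiFiber A) z₀).baseSet := mem_chartAt_source_iff.1 hz
  have hp := mem_coordDomain_piFiber hz
  have hev : sectionCoord 𝓘(ℝ, E).tangent E z₀ (constSection E z₀ c : ∀ z, PiFiber A z)
      =ᶠ[𝓝 (extChartAt 𝓘(ℝ, E).tangent z₀ z)] fun _ => c := by
    filter_upwards [(isOpen_coordDomain z₀).mem_nhds hp] with q hq
      using sectionCoord_constSection c hq
  rw [covariantDerivative_coord D hz hz' (mdifferentiableAt_constSection hz' c), hev.fderiv_eq,
    fderiv_const_apply, constSection,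
    (trivializationAt E (PiFiber A) z₀).continuousLinearMapAt_symmL hz']
  exact zero_add _

theorem coord_metrical (hF : IsFinslerFunction F A) (hD : IsCartanConnection F D) {z₀ z : A}
    (hz : z ∈ (chartAt (ModelProd E E) z₀).source) (X : E × E) (a b : E) :
    fderiv ℝ (vertHessian (coordEnergy F z₀)) (extChartAt 𝓘(ℝ, E).tangent z₀ z) X a b
      = vertHessian (coordEnergy F z₀) (extChartAt 𝓘(ℝ, E).tangent z₀ z)
          (christoffel D z₀ (extChartAt 𝓘(ℝ, E).tangent z₀ z) X a) b
        + vertHessian (coordEnergy F z₀) (extChartAt 𝓘(ℝ, E).tangent z₀ z) a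
          (christoffel D z₀ (extChartAt 𝓘(ℝ, E).tangent z₀ z) X b) := by
  have hz' : z ∈ (trivializationAt E (PiFiber A) z₀).baseSet := mem_chartAt_source_iff.1 hz
  have hp := mem_coordDomain_piFiber hz
  have hev : (fun w => finslerMetric F A w (constSection E z₀ a w) (constSection E z₀ b w))
      ∘ (extChartAt 𝓘(ℝ, E).tangent z₀).symm =ᶠ[𝓝 (extChartAt 𝓘(ℝ, E).tangent z₀ z)]
      fun q => vertHessian (coordEnergy F z₀) q a b := by
    filter_upwards [(isOpen_coordDomain z₀).mem_nhds hp] with q hq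
    obtain ⟨w, hw, rfl⟩ := exists_extChartAt_eq hq
    rw [Function.comp_apply,
      (extChartAt 𝓘(ℝ, E).tangent z₀).left_inv (by rwa [extChartAt_source]),
      finslerMetric_constSection hF hw]
  have hder := (((((contDiffOn_vertHessian (isOpen_coordDomain z₀)
    (contDiffOn_coordEnergy hF z₀)).contDiffAt ((isOpen_coordDomain z₀).mem_nhds
      hp)).differentiableAt (by simp)).hasFDerivAt.clm_apply
        (hasFDerivAt_const a _)).clm_apply (hasFDerivAt_const b _)).congr_of_eventuallyEq hev
  have h2 := mvfderiv_eq_fderiv_comp hz ((mdifferentiableAt_iff_comp_extChartAt_symm hz).2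
    hder.differentiableAt) ((trivializationAt (E × E)
    (TangentSpace 𝓘(ℝ, E).tangent) z₀).symmL ℝ z X)
  have h1 := hD.metrical z ((trivializationAt (E × E)
    (TangentSpace 𝓘(ℝ, E).tangent) z₀).symmL ℝ z X) _ _
    (mdifferentiableAt_constSection hz' a) (mdifferentiableAt_constSection hz' b)
  have h3 := h2.symm.trans h1
  rw [finslerMetric_coord hF hz, finslerMetric_coord hF hz,
    covariantDerivative_constSection_coord hz, covariantDerivative_constSection_coord hz,
    continuousLinearMapAt_symmL_tangent hz, hder.fderiv, constSection, constSection,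
    (trivializationAt E (PiFiber A) z₀).continuousLinearMapAt_symmL hz',
    (trivializationAt E (PiFiber A) z₀).continuousLinearMapAt_symmL hz'] at h3
  simpa only [add_apply, ContinuousLinearMap.comp_apply, ContinuousLinearMap.flip_apply,
    zero_apply, map_zero, zero_add] using h3

theorem coord_hTorsion (hD : IsCartanConnection F D) {z₀ z : A}
    (hz : z ∈ (chartAt (ModelProd E E) z₀).source) {X Y : E × E}
    (hX : X.2 + christoffel D z₀ (extChartAt 𝓘(ℝ, E).tangent z₀ z) X
      (extChartAt 𝓘(ℝ, E).tangent z₀ z).2 = 0)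
    (hY : Y.2 + christoffel D z₀ (extChartAt 𝓘(ℝ, E).tangent z₀ z) Y
      (extChartAt 𝓘(ℝ, E).tangent z₀ z).2 = 0) :
    christoffel D z₀ (extChartAt 𝓘(ℝ, E).tangent z₀ z) X Y.1
      = christoffel D z₀ (extChartAt 𝓘(ℝ, E).tangent z₀ z) Y X.1 := by
  have hhor {X : E × E} (hX : X.2 + christoffel D z₀ (extChartAt 𝓘(ℝ, E).tangent z₀ z) X
      (extChartAt 𝓘(ℝ, E).tangent z₀ z).2 = 0) :
      (trivializationAt (E × E) (TangentSpace 𝓘(ℝ, E).tangent) z₀).symmL ℝ z X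
        ∈ horizontalSpace D z :=
    (mem_horizontalSpace_iff D hz _).2 (by rwa [continuousLinearMapAt_symmL_tangent hz])
  have h1 := hD.hTorsion_eq_zero z _ (hhor hX) _ (hhor hY)
  have h2 := torsion_coord D hz
    ((trivializationAt (E × E) (TangentSpace 𝓘(ℝ, E).tangent) z₀).symmL ℝ z X)
    ((trivializationAt (E × E) (TangentSpace 𝓘(ℝ, E).tangent) z₀).symmL ℝ z Y)
  rw [h1, map_zero, continuousLinearMapAt_symmL_tangent hz,
    continuousLinearMapAt_symmL_tangent hz] at h2
  exact sub_eq_zero.1 h2.symm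

/-- Regularity gives a horizontal vector over every `a`. -/
theorem exists_mem_horizontalSpace (hD : IsCartanConnection F D) {z₀ z : A}
    (hz : z ∈ (chartAt (ModelProd E E) z₀).source) (a : E) :
    ∃ X ∈ horizontalSpace D z, ((trivializationAt (E × E)
      (TangentSpace 𝓘(ℝ, E).tangent) z₀).continuousLinearMapAt ℝ z X).1 = a := by
  obtain ⟨V, hV, X, hX, hVX⟩ := Submodule.mem_sup.1 ((hD.regular z).sup_eq_top ▸
    Submodule.mem_top (x := (trivializationAt (E × E)
      (TangentSpace 𝓘(ℝ, E).tangent) z₀).symmL ℝ z (a, 0)))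
  refine ⟨X, hX, ?_⟩
  have h1 := congrArg (fun Y => ((trivializationAt (E × E)
    (TangentSpace 𝓘(ℝ, E).tangent) z₀).continuousLinearMapAt ℝ z Y).1) hVX
  rw [continuousLinearMapAt_symmL_tangent hz, map_add, Prod.fst_add,
    (mem_verticalSpace_iff hz V).1 hV, zero_add] at h1
  exact h1

theorem coord_hvTorsion (hF : IsFinslerFunction F A) (hD : IsCartanConnection F D) {z₀ z : A}
    (hz : z ∈ (chartAt (ModelProd E E) z₀).source) (v a b : E) :
    vertHessian (coordEnergy F z₀) (extChartAt 𝓘(ℝ, E).tangent z₀ z)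
        (christoffel D z₀ (extChartAt 𝓘(ℝ, E).tangent z₀ z) (0, v) a) b
      = vertHessian (coordEnergy F z₀) (extChartAt 𝓘(ℝ, E).tangent z₀ z)
        (christoffel D z₀ (extChartAt 𝓘(ℝ, E).tangent z₀ z) (0, v) b) a := by
  obtain ⟨X, hX, rfl⟩ := exists_mem_horizontalSpace hD hz a
  obtain ⟨Y, hY, rfl⟩ := exists_mem_horizontalSpace hD hz b
  have h1 := hD.hvTorsion_symm z ((trivializationAt (E × E)
      (TangentSpace 𝓘(ℝ, E).tangent) z₀).symmL ℝ z (0, v))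
      ((mem_verticalSpace_iff hz _).2 (by rw [continuousLinearMapAt_symmL_tangent hz])) X hX Y hY
  rw [finslerMetric_coord hF hz, finslerMetric_coord hF hz, torsion_coord D hz,
    torsion_coord D hz, continuousLinearMapAt_piStar hz, continuousLinearMapAt_piStar hz,
    continuousLinearMapAt_symmL_tangent hz, map_zero, map_zero, sub_zero, sub_zero] at h1
  exact h1

/-- In the chart and trivialization at `z₀`, the Cartan connection and the Finsler metric satisfy
the coordinate form of the axioms. -/
theorem isCoordCartan (hF : IsFinslerFunction F A) (hD : IsCartanConnection F D) (z₀ : A) :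
    IsCoordCartan (coordDomain 𝓘(ℝ, E).tangent E (PiFiber A) z₀) (christoffel D z₀)
      (vertHessian (coordEnergy F z₀)) where
  isOpen := isOpen_coordDomain z₀
  contDiffOn_conn := contDiffOn_christoffel D z₀
    (hD.smooth _ (trivializationAt E (PiFiber A) z₀).open_baseSet)
  contDiffOn_metric := contDiffOn_vertHessian (isOpen_coordDomain z₀) (contDiffOn_coordEnergy hF z₀)
  metric_symm p hp a b := vertHessian_symm
    ((contDiffOn_coordEnergy hF z₀).contDiffAt ((isOpen_coordDomain z₀).mem_nhds hp)) a b
  metric_nondegenerate p hp a h := by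
    obtain ⟨z, hz, rfl⟩ := exists_extChartAt_eq hp
    exact coord_metric_nondegenerate hF hz h
  fderiv_metric_symm p hp := fderiv_vertHessian_symm (isOpen_coordDomain z₀)
    (contDiffOn_coordEnergy hF z₀) hp
  fderiv_metric_homogeneous p hp := fderiv_vertHessian_self_of_homogeneous
    (isOpen_coordDomain z₀) (contDiffOn_coordEnergy hF z₀) hp
    fun q hq t ht => coordEnergy_smul hF hq ht
  metrical p hp X a b := by
    obtain ⟨z, hz, rfl⟩ := exists_extChartAt_eq hp
    exact coord_metrical hF hD hz X a b
  hTorsion p hp X Y hX hY := by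
    obtain ⟨z, hz, rfl⟩ := exists_extChartAt_eq hp
    exact coord_hTorsion hD hz hX hY
  hvTorsion p hp v a b := by
    obtain ⟨z, hz, rfl⟩ := exists_extChartAt_eq hp
    exact coord_hvTorsion hF hD hz v a b

end CartanCoordinates

/-! ### The h-curvature -/

section HorizontalCurvature

set_option synthInstance.maxHeartbeats 100000

variable {E : Type*} [NormedAddCommGroup E] [NormedSpace ℝ E] [FiniteDimensional ℝ E]
  {M : Type*} [TopologicalSpace M] [ChartedSpace E M] [IsManifold 𝓘(ℝ, E) ∞ M]
  {A : Opens (TangentBundle 𝓘(ℝ, E) M)} {F : TangentBundle 𝓘(ℝ, E) M → ℝ} {D : PiConnection A}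

theorem continuousLinearMapAt_of_mem_horizontalSpace (hF : IsFinslerFunction F A)
    (hD : IsCartanConnection F D) {z₀ z : A} (hz : z ∈ (chartAt (ModelProd E E) z₀).source)
    {X : TangentSpace 𝓘(ℝ, E).tangent z} (hX : X ∈ horizontalSpace D z) :
    (trivializationAt (E × E) (TangentSpace 𝓘(ℝ, E).tangent) z₀).continuousLinearMapAt ℝ z X
      = coordLift (christoffel D z₀) (extChartAt 𝓘(ℝ, E).tangent z₀ z)
        ((trivializationAt E (PiFiber A) z₀).continuousLinearMapAt ℝ z (piStar A z X)) := by
  rw [continuousLinearMapAt_piStar hz]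
  exact ((isCoordCartan hF hD z₀).horizontal_iff (mem_coordDomain_piFiber hz) _).1
    ((mem_horizontalSpace_iff D hz X).1 hX)

theorem horizontalLift_spec (hD : IsCartanConnection F D) (z : A) (a : PiFiber A z) :
    horizontalLift D z a ∈ horizontalSpace D z ∧ piStar A z (horizontalLift D z a) = a := by
  have hz : z ∈ (chartAt (ModelProd E E) z).source := mem_chart_source _ z
  obtain ⟨X, hX, hXa⟩ := exists_mem_horizontalSpace hD hz
    ((trivializationAt E (PiFiber A) z).continuousLinearMapAt ℝ z a)
  rw [← continuousLinearMapAt_piStar hz] at hXa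
  have h : ∃ X ∈ (horizontalSpace D z : Set (TangentSpace 𝓘(ℝ, E).tangent z)),
      (fun X => piStar A z X) X = a :=
    ⟨X, hX, continuousLinearMapAt_injective (mem_baseSet_piFiber_iff.2
      (mem_chartAt_source_iff.1 hz)) hXa⟩
  exact ⟨Function.invFunOn_mem h, Function.invFunOn_eq h⟩

theorem hCurvature_coord (hF : IsFinslerFunction F A) (hD : IsCartanConnection F D) {z₀ z : A}
    (hz : z ∈ (chartAt (ModelProd E E) z₀).source) (a b c : PiFiber A z) :
    (trivializationAt E (PiFiber A) z₀).continuousLinearMapAt ℝ z (hCurvature D z a b c)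
      = coordCurvature (christoffel D z₀) (extChartAt 𝓘(ℝ, E).tangent z₀ z)
        (coordLift (christoffel D z₀) (extChartAt 𝓘(ℝ, E).tangent z₀ z)
          ((trivializationAt E (PiFiber A) z₀).continuousLinearMapAt ℝ z a))
        (coordLift (christoffel D z₀) (extChartAt 𝓘(ℝ, E).tangent z₀ z)
          ((trivializationAt E (PiFiber A) z₀).continuousLinearMapAt ℝ z b))
        ((trivializationAt E (PiFiber A) z₀).continuousLinearMapAt ℝ z c) := by
  rw [hCurvature, curvature_eq_coord D hz
    (hD.smooth _ (trivializationAt E (PiFiber A) z₀).open_baseSet),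
    continuousLinearMapAt_of_mem_horizontalSpace hF hD hz (horizontalLift_spec hD z a).1,
    continuousLinearMapAt_of_mem_horizontalSpace hF hD hz (horizontalLift_spec hD z b).1,
    (horizontalLift_spec hD z a).2, (horizontalLift_spec hD z b).2]

/-- On horizontal fields the contracted curvature is the negative of the vertical part of the
bracket, since `D_Y η = 0` for horizontal `Y`. -/
theorem contractedCurvature_eq_neg (hF : IsFinslerFunction F A) (hD : IsCartanConnection F D)
    {U : Set A} (hU : IsOpen U) {X Y : ∀ z : A, TangentSpace 𝓘(ℝ, E).tangent z}
    (hX : ContMDiffOn 𝓘(ℝ, E).tangent 𝓘(ℝ, E).tangent.tangent ∞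
      (fun z => (⟨z, X z⟩ : TangentBundle 𝓘(ℝ, E).tangent A)) U)
    (hY : ContMDiffOn 𝓘(ℝ, E).tangent 𝓘(ℝ, E).tangent.tangent ∞
      (fun z => (⟨z, Y z⟩ : TangentBundle 𝓘(ℝ, E).tangent A)) U)
    (hXh : ∀ z ∈ U, X z ∈ horizontalSpace D z) (hYh : ∀ z ∈ U, Y z ∈ horizontalSpace D z)
    {z : A} (hz : z ∈ U) :
    contractedCurvature D z (piStar A z (X z)) (piStar A z (Y z))
      = -D (eta A) z (VectorField.mlieBracket 𝓘(ℝ, E).tangent X Y z) := by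
  have hz₀ : z ∈ (chartAt (ModelProd E E) z).source := mem_chart_source _ z
  have hz' := mem_baseSet_piFiber_iff.2 (mem_chartAt_source_iff.1 hz₀)
  have hzero {Y : ∀ z : A, TangentSpace 𝓘(ℝ, E).tangent z}
      (hYh : ∀ z ∈ U, Y z ∈ horizontalSpace D z) : D (fun w => D (eta A) w (Y w)) z = 0 := by
    have hev : ∀ᶠ w in 𝓝 z, D (eta A) w (Y w) = (0 : ∀ w, PiFiber A w) w := by
      filter_upwards [hU.mem_nhds hz] with w hw using LinearMap.mem_ker.1 (hYh w hw)
    have h0 : MDifferentiableAt 𝓘(ℝ, E).tangent (𝓘(ℝ, E).tangent.prod 𝓘(ℝ, E))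
        (fun w => (⟨w, (0 : ∀ w, PiFiber A w) w⟩ : TotalSpace E (PiFiber A))) z :=
      mdifferentiableAt_zeroSection ..
    have h := D.isCovariantDerivativeOnUniv.congr_of_eventuallyEq
      (h0.congr_of_eventuallyEq (hev.mono fun w hw => congrArg (TotalSpace.mk w) hw)) h0
      Filter.univ_mem hev
    exact h.trans (congrFun D.zero z)
  have h := curvature_coord D hz₀ hz'
    (hD.smooth _ (trivializationAt E (PiFiber A) z).open_baseSet)
    ((hX.contMDiffAt (hU.mem_nhds hz)).mdifferentiableAt (by simp))
    ((hY.contMDiffAt (hU.mem_nhds hz)).mdifferentiableAt (by simp))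
    ((contMDiff_eta z).of_le (WithTop.coe_le_coe.2 le_top) : ContMDiffAt _ _ 2 _ z)
  rw [continuousLinearMapAt_of_mem_horizontalSpace hF hD hz₀ (hXh z hz),
    continuousLinearMapAt_of_mem_horizontalSpace hF hD hz₀ (hYh z hz),
    ← hCurvature_coord hF hD hz₀, hzero hXh, hzero hYh] at h
  rw [contractedCurvature, ← continuousLinearMapAt_injective hz' h, zero_apply, zero_apply,
    sub_zero, zero_sub]

/-- The horizontal field that projects to the section constant in the trivialization at `z₀`. -/
noncomputable def constLift (D : PiConnection A) (z₀ : A) (a : E) (z : A) :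
    TangentSpace 𝓘(ℝ, E).tangent z :=
  (trivializationAt (E × E) (TangentSpace 𝓘(ℝ, E).tangent) z₀).symmL ℝ z
    (coordLift (christoffel D z₀) (extChartAt 𝓘(ℝ, E).tangent z₀ z) a)

theorem constLift_mem_horizontalSpace (hF : IsFinslerFunction F A) (hD : IsCartanConnection F D)
    {z₀ z : A} (hz : z ∈ (chartAt (ModelProd E E) z₀).source) (a : E) :
    constLift D z₀ a z ∈ horizontalSpace D z := by
  rw [mem_horizontalSpace_iff D hz, constLift, continuousLinearMapAt_symmL_tangent hz]
  exact ((isCoordCartan hF hD z₀).horizontal_iff (mem_coordDomain_piFiber hz) _).2 rfl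

theorem continuousLinearMapAt_piStar_constLift {z₀ z : A}
    (hz : z ∈ (chartAt (ModelProd E E) z₀).source) (a : E) :
    (trivializationAt E (PiFiber A) z₀).continuousLinearMapAt ℝ z
      (piStar A z (constLift D z₀ a z)) = a := by
  rw [continuousLinearMapAt_piStar hz, constLift, continuousLinearMapAt_symmL_tangent hz]
  rfl

theorem contMDiffOn_constLift (hD : IsCartanConnection F D) (z₀ : A) (a : E) :
    ContMDiffOn 𝓘(ℝ, E).tangent 𝓘(ℝ, E).tangent.tangent ∞
      (fun z => (⟨z, constLift D z₀ a z⟩ : TangentBundle 𝓘(ℝ, E).tangent A))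
      (chartAt (ModelProd E E) z₀).source := by
  have hlift : ContDiffOn ℝ ∞ (fun q => coordLift (christoffel D z₀) q a)
      (coordDomain 𝓘(ℝ, E).tangent E (PiFiber A) z₀) :=
    contDiffOn_const.prodMk (((contDiffOn_christoffel D z₀ (hD.smooth _
      (trivializationAt E (PiFiber A) z₀).open_baseSet)).clm_apply contDiffOn_const).clm_apply
        contDiff_snd.contDiffOn).neg
  have h1 := hlift.contMDiffOn.comp
    (contMDiffOn_extChartAt (I := 𝓘(ℝ, E).tangent) (n := ∞) (x := z₀))
    fun z hz => mem_coordDomain_piFiber hz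
  refine ((trivializationAt (E × E) (TangentSpace 𝓘(ℝ, E).tangent)
    z₀).contMDiffOn_section_baseSet_iff).2 (h1.congr fun w hw => ?_)
  rw [snd_trivializationAt_eq hw, constLift]
  exact continuousLinearMapAt_symmL_tangent hw _

theorem contractedCurvature_eq_zero_iff (hF : IsFinslerFunction F A) (hD : IsCartanConnection F D) :
    (∀ z a b, contractedCurvature D z a b = 0) ↔ HorizontalIntegrable D := by
  constructor
  · intro h U hU X Y hX hY hXh hYh z hz
    have := contractedCurvature_eq_neg hF hD hU hX hY hXh hYh hz
    rw [h, zero_eq_neg] at this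
    exact this
  · intro h z a b
    have hz : z ∈ (chartAt (ModelProd E E) z).source := mem_chart_source _ z
    have hinj := continuousLinearMapAt_injective (mem_baseSet_piFiber_iff.2
      (mem_chartAt_source_iff.1 hz))
    have hlift (a : PiFiber A z) : piStar A z (constLift D z
        ((trivializationAt E (PiFiber A) z).continuousLinearMapAt ℝ z a) z) = a :=
      hinj (continuousLinearMapAt_piStar_constLift hz _)
    have hU := (chartAt (ModelProd E E) z).open_source
    have h1 := contractedCurvature_eq_neg hF hD hU
      (contMDiffOn_constLift hD z ((trivializationAt E (PiFiber A) z).continuousLinearMapAt ℝ z a))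
      (contMDiffOn_constLift hD z ((trivializationAt E (PiFiber A) z).continuousLinearMapAt ℝ z b))
      (fun w hw => constLift_mem_horizontalSpace hF hD hw _)
      (fun w hw => constLift_mem_horizontalSpace hF hD hw _) hz
    have h2 := h _ hU _ _
      (contMDiffOn_constLift hD z ((trivializationAt E (PiFiber A) z).continuousLinearMapAt ℝ z a))
      (contMDiffOn_constLift hD z ((trivializationAt E (PiFiber A) z).continuousLinearMapAt ℝ z b))
      (fun w hw => constLift_mem_horizontalSpace hF hD hw _)
      (fun w hw => constLift_mem_horizontalSpace hF hD hw _) z hz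
    rw [hlift, hlift] at h1
    rw [h1, neg_eq_zero]
    exact h2

/-- If `R̂(a, b) = μ (l(a) b - l(b) a)`, the right-hand side of the first Bianchi identity cancels
by the symmetry of the Cartan tensor. -/
theorem cyclicIdentity_of_contracted (hF : IsFinslerFunction F A) (hD : IsCartanConnection F D)
    {μ : A → ℝ} {l : ∀ z, PiFiber A z → ℝ}
    (h : ∀ z a b, contractedCurvature D z a b = μ z • (l z a • b - l z b • a)) :
    CyclicIdentity D := by
  intro z a b c
  have hz : z ∈ (chartAt (ModelProd E E) z).source := mem_chart_source _ z
  have hinj := continuousLinearMapAt_injective (mem_baseSet_piFiber_iff.2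
      (mem_chartAt_source_iff.1 hz))
  have hC := isCoordCartan hF hD z
  have hp := mem_coordDomain_piFiber hz
  refine (map_eq_zero_iff _ hinj).1 ?_
  have hcon (a b : PiFiber A z) := congrArg
    ((trivializationAt E (PiFiber A) z).continuousLinearMapAt ℝ z) (h z a b)
  simp only [contractedCurvature, hCurvature_coord hF hD hz, continuousLinearMapAt_eta hz, map_smul,
    map_sub] at hcon
  have hsmul (s : ℝ) (v w c : E) (s₁ s₂ : ℝ) :
      christoffel D z (extChartAt 𝓘(ℝ, E).tangent z z) (0, s • (s₁ • v - s₂ • w)) c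
      = s • (s₁ • christoffel D z (extChartAt 𝓘(ℝ, E).tangent z z) (0, v) c
        - s₂ • christoffel D z (extChartAt 𝓘(ℝ, E).tangent z z) (0, w) c) := by
    rw [show ((0, s • (s₁ • v - s₂ • w)) : E × E) = s • (s₁ • (0, v) - s₂ • (0, w)) by simp]
    simp only [map_smul, map_sub, smul_apply, sub_apply]
  rw [map_add, map_add, hCurvature_coord hF hD hz, hCurvature_coord hF hD hz,
    hCurvature_coord hF hD hz, hC.cyclic_coordCurvature hp, hcon, hcon, hcon, hsmul, hsmul, hsmul]
  set a' := (trivializationAt E (PiFiber A) z).continuousLinearMapAt ℝ z a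
  set b' := (trivializationAt E (PiFiber A) z).continuousLinearMapAt ℝ z b
  set c' := (trivializationAt E (PiFiber A) z).continuousLinearMapAt ℝ z c
  rw [hC.vertical_symm hp b' a', hC.vertical_symm hp c' a', hC.vertical_symm hp c' b']
  module

theorem hCurvature_swap (hF : IsFinslerFunction F A) (hD : IsCartanConnection F D) (z : A)
    (a b c : PiFiber A z) : hCurvature D z a b c = -hCurvature D z b a c := by
  have hz : z ∈ (chartAt (ModelProd E E) z).source := mem_chart_source _ z
  refine continuousLinearMapAt_injective (mem_baseSet_piFiber_iff.2
      (mem_chartAt_source_iff.1 hz)) ?_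
  rw [map_neg, hCurvature_coord hF hD hz, hCurvature_coord hF hD hz, coordCurvature, coordCurvature]
  abel

theorem finslerMetric_hCurvature_skew (hF : IsFinslerFunction F A) (hD : IsCartanConnection F D)
    (z : A) (a b c d : PiFiber A z) :
    finslerMetric F A z (hCurvature D z a b c) d
      = -finslerMetric F A z (hCurvature D z a b d) c := by
  have hz : z ∈ (chartAt (ModelProd E E) z).source := mem_chart_source _ z
  have hC := isCoordCartan hF hD z
  rw [finslerMetric_coord hF hz, finslerMetric_coord hF hz, hCurvature_coord hF hD hz,
    hCurvature_coord hF hD hz, hC.metric_symm _ (mem_coordDomain_piFiber hz)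
      (coordCurvature _ _ _ _ ((trivializationAt E (PiFiber A) z).continuousLinearMapAt ℝ z d))]
  exact eq_neg_of_add_eq_zero_left (hC.coordCurvature_skew (mem_coordDomain_piFiber hz) _ _ _ _)

theorem finslerMetric_hCurvature_pair_symm (hF : IsFinslerFunction F A)
    (hD : IsCartanConnection F D) (hcyc : CyclicIdentity D) (z : A) (a b c d : PiFiber A z) :
    finslerMetric F A z (hCurvature D z a b c) d = finslerMetric F A z (hCurvature D z c d a) b :=
  pair_symm_of_cyclic (r := fun a b c d => finslerMetric F A z (hCurvature D z a b c) d)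
    (fun a b c d => by rw [hCurvature_swap hF hD, finslerMetric_neg_left hF])
    (fun a b c d => finslerMetric_hCurvature_skew hF hD z a b c d)
    (fun a b c d => by
      rw [← finslerMetric_add_left hF, ← finslerMetric_add_left hF, hcyc,
        finslerMetric_zero_left hF]) a b c d

theorem mem_nullitySpace_iff (hD : IsCartanConnection F D) {z : A} {a : PiFiber A z} :
    a ∈ nullitySpace D z ↔ ∀ b c, hCurvature D z a b c = 0 := by
  constructor
  · rintro ⟨X, ⟨-, hX⟩, rfl⟩ b c
    have := hX _ (horizontalLift_spec hD z b).1 c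
    rwa [(horizontalLift_spec hD z b).2] at this
  · intro h
    exact ⟨horizontalLift D z a, ⟨(horizontalLift_spec hD z a).1, fun Y _ c => by
      rw [(horizontalLift_spec hD z a).2, h]⟩, (horizontalLift_spec hD z a).2⟩

theorem mem_kernelSpace_iff (hD : IsCartanConnection F D) {z : A} {c : PiFiber A z} :
    c ∈ kernelSpace D z ↔ ∀ a b, hCurvature D z a b c = 0 := by
  constructor
  · intro h a b
    have := h _ (horizontalLift_spec hD z a).1 _ (horizontalLift_spec hD z b).1
    rwa [(horizontalLift_spec hD z a).2, (horizontalLift_spec hD z b).2] at this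
  · intro h Y _ Z _
    exact h _ _

/-- By pair symmetry, `g(R(a, b) c, d) = g(R(c, d) a, b)`, so that `a` annihilates `R` in the first
slot if and only if it does in the third. -/
theorem nullitySpace_eq_kernelSpace (hF : IsFinslerFunction F A)
    (hD : IsCartanConnection F D) (hcyc : CyclicIdentity D) (z : A) :
    nullitySpace D z = kernelSpace D z := by
  ext a
  rw [mem_nullitySpace_iff hD, mem_kernelSpace_iff hD]
  constructor
  · intro h b c
    refine hF.nondegenerate z _ fun d => ?_
    rw [finslerMetric_hCurvature_pair_symm hF hD hcyc, h, finslerMetric_zero_left hF]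
  · intro h b c
    refine hF.nondegenerate z _ fun d => ?_
    rw [finslerMetric_hCurvature_pair_symm hF hD hcyc, h, finslerMetric_zero_left hF]

end HorizontalCurvature

end FinslerGeometry

theorem mainTheorem3
    {E : Type*} [NormedAddCommGroup E] [NormedSpace ℝ E] [FiniteDimensional ℝ E]
    {M : Type*} [TopologicalSpace M] [ChartedSpace E M] [IsManifold 𝓘(ℝ, E) ∞ M]
    (A : TopologicalSpace.Opens (TangentBundle 𝓘(ℝ, E) M))
    (F : TangentBundle 𝓘(ℝ, E) M → ℝ)
    (hF : FinslerGeometry.IsFinslerFunction F A)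
    (D : FinslerGeometry.PiConnection A)
    (hD : FinslerGeometry.IsCartanConnection F D) :
    ((∀ z a b, FinslerGeometry.contractedCurvature D z a b = 0) ↔
        FinslerGeometry.HorizontalIntegrable D) ∧
    (((∀ z a b, FinslerGeometry.contractedCurvature D z a b = 0) ∨
        FinslerGeometry.IsotropyCondition F D) →
      FinslerGeometry.CyclicIdentity D ∧
      ∀ z, FinslerGeometry.nullitySpace D z = FinslerGeometry.kernelSpace D z) := by
  refine ⟨FinslerGeometry.contractedCurvature_eq_zero_iff hF hD, fun h => ?_⟩
  have hcyc : FinslerGeometry.CyclicIdentity D := by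
    rcases h with h | ⟨lam, -, h⟩
    · exact FinslerGeometry.cyclicIdentity_of_contracted hF hD (μ := 0) (l := fun _ _ => 0)
        fun z a b => by rw [h, Pi.zero_apply, zero_smul]
    · exact FinslerGeometry.cyclicIdentity_of_contracted hF hD
        (μ := fun z => lam z.1 * F z.1) (l := FinslerGeometry.ell F A) h
  exact ⟨hcyc, FinslerGeometry.nullitySpace_eq_kernelSpace hF hD hcyc⟩
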